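/- **Setting.** Consider an $N$-player game in which player $i$ chooses $x^i\in\mathbb{R}^{d_i}$ and has loss $\ell^i(x)$, $x=(x^1,\dots,x^N)\in\mathcal X=\prod_i\mathbb{R}^{d_i}$ (Euclidean norms, $\|x\|^2=\sum_i\|x^i\|^2$). Write $V^i(x)=\nabla_{x^i}\ell^i(x)$ and $V=(V^i)_i$. A point $x_\star$ is a Nash equilibrium if $\ell^i(x_\star)\le\ell^i(y,x_\star^{-i})$ for all $i$ and $y\in\mathbb{R}^{d_i}$. Assume: 1. each $\ell^i$ is convex and differentiable in $x^i$, and each $V^i$ is $L$-Lipschitz on $\mathcal X$; 2. (variational stability) the set of Nash equilibria is non-empty and $\langle V(x),x-x_\star\rangle\ge0$ for every $x\in\mathcal X$ and every Nash equilibrium $x_\star$. At each round $t=1,2,\dots$ the joint action $X_{t+1/2}$ is played and player $i$ observes $g^i_t=V^i(X_{t+1/2})+\xi^i_t$; set $g^i_0=0$. Let $\mathcal F_t$ be the $\sigma$-algebra generated by $X_{3/2},\dots,X_{t+1/2}$. Assume further, for all $t\ge1$ and all $i$: 3. (multiplicative noise) $\mathbb E[\xi^i_t\mid\mathcal F_t]=0$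 and $\mathbb E[\|\xi^i_t\|^2\mid\mathcal F_t]\le\sigma_M^2\|V^i(X_{t+1/2})\|^2$ almost surely, for a constant $\sigma_M$; 4. (bounded feedback) $\|V^i(x)\|\le G$ for all $x\in\mathcal X$, and $\|\xi^i_t\|\le\bar\sigma$ almost surely, for constants $G,\bar\sigma$. Let $q\in(0,1/4]$, let $X_1$ be deterministic or, more generally, an almost surely bounded random vector, and let all players run adaptive OptDA+: for $t\ge1$, $$X^i_{t+1/2}=X^i_t-\gamma^i_t g^i_{t-1},\qquad X^i_{t+1}=X^i_1-\eta^i_{t+1}\sum_{s=1}^{t}g^i_s,$$ where, with $\lambda^i_t=\sum_{s=1}^{t}\|g^i_s\|^2$ and $\mu^i_t=\sum_{s=1}^{t}\|X^i_s-X^i_{s+1}\|^2$ (both $0$ for $t\le0$), $$\gamma^i_t=\frac{1}{(1+\lambda^i_{t-2})^{1/2-q}},\qquad \eta^i_t=\frac{1}{\sqrt{1+\lambda^i_{t-2}+\mu^i_{t-2}}}.$$ **Theorem.** Almost surely: - for every $i$, the sequences $(\lambda^i_t)_t$ and $(\mu^i_t)_t$ converge to finite limits, and the step sizes $(\gamma^i_t)_t$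 and $(\eta^i_t)_t$ converge to positive limits (the limits may be random); - $\sum_{t\ge1}\|V(X_{t+1/2})\|^2<\infty$; - $(X_t)_t$ and $(X_{t+1/2})_t$ both converge to the same (possibly random) Nash equilibrium. -/

import Mathlib

open MeasureTheory Filter Topology
open scoped NNReal

noncomputable section

namespace NoisyGame

/-- Player `i`'s action space, the Euclidean space of dimension `d i`. -/
abbrev Action {N : ℕ} (d : Fin N → ℕ) (i : Fin N) : Type := EuclideanSpace ℝ (Fin (d i))

/-- Joint actions `x = (xⁱ)ᵢ`, with `‖x‖² = ∑ᵢ ‖xⁱ‖²`. -/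
abbrev JointAction {N : ℕ} (d : Fin N → ℕ) : Type := PiLp 2 (fun i => Action d i)

section Game

variable {N : ℕ} {d : Fin N → ℕ}

/-- The joint action `(y, x⁻ⁱ)`: player `i` plays `y`, the others play as in `x`. -/
def deviate (x : JointAction d) (i : Fin N) (y : Action d i) : JointAction d :=
  WithLp.toLp 2 (Function.update (WithLp.ofLp x) i y)

/-- Nash equilibria of the game with losses `ℓ`. -/
def IsNash (ℓ : Fin N → JointAction d → ℝ) (x : JointAction d) : Prop :=
  ∀ (i : Fin N) (y : Action d i), ℓ i x ≤ ℓ i (deviate x i y)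

/-- The individual gradient `Vⁱ(x)`, i.e. the gradient of `ℓⁱ` in player `i`'s own action. -/
def indivGrad (ℓ : Fin N → JointAction d → ℝ) (i : Fin N) (x : JointAction d) : Action d i :=
  gradient (fun y => ℓ i (deviate x i y)) (x i)

/-- The joint vector field `V(x) = (Vⁱ(x))ᵢ`. -/
def jointGrad (ℓ : Fin N → JointAction d → ℝ) (x : JointAction d) : JointAction d :=
  WithLp.toLp 2 (fun i => indivGrad ℓ i x)

/-- Every loss is convex and differentiable in the player's own action, and every individual
gradient is `L`-Lipschitz in the joint action. -/
structure ConvexSmooth (ℓ : Fin N → JointAction d → ℝ) (L : ℝ≥0) : Prop where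
  convex : ∀ (i : Fin N) (x : JointAction d),
    ConvexOn ℝ Set.univ (fun y : Action d i => ℓ i (deviate x i y))
  differentiable : ∀ (i : Fin N) (x : JointAction d),
    Differentiable ℝ (fun y : Action d i => ℓ i (deviate x i y))
  lipschitz : ∀ i : Fin N, LipschitzWith L (indivGrad ℓ i)

/-- Variational stability: a Nash equilibrium exists, and `⟨V(x), x - x⋆⟩ ≥ 0` for every joint
action `x` and every Nash equilibrium `x⋆`. -/
structure VariationallyStable (ℓ : Fin N → JointAction d → ℝ) : Prop where
  exists_nash : ∃ x : JointAction d, IsNash ℓ x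
  inner_nonneg : ∀ x xs : JointAction d, IsNash ℓ xs → 0 ≤ inner ℝ (jointGrad ℓ x) (x - xs)

end Game

section Dynamics

variable {N : ℕ} {d : Fin N → ℕ} {Ω : Type*}

/-- The feedback `gⁱ_t = Vⁱ(x_t) + ξⁱ_t` received for the joint action `x_t` at round `t ≥ 1`,
with the convention `gⁱ_0 = 0`. -/
def feedback (ℓ : Fin N → JointAction d → ℝ) (x : ℕ → Ω → JointAction d)
    (ξ : ℕ → (i : Fin N) → Ω → Action d i) (t : ℕ) (i : Fin N) (ω : Ω) : Action d i :=
  if t = 0 then 0 else indivGrad ℓ i (x t ω) + ξ t i ω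

/-- `∑_{s=1}^t ‖gⁱ_s‖²` (zero for `t = 0`). -/
def cumSq (g : ℕ → (i : Fin N) → Ω → Action d i) (t : ℕ) (i : Fin N) (ω : Ω) : ℝ :=
  ∑ s ∈ Finset.Icc 1 t, ‖g s i ω‖ ^ 2

/-- `∑_{s=1}^t ‖Xⁱ_s - Xⁱ_{s+1}‖²` (zero for `t = 0`). -/
def pathSq (X : ℕ → Ω → JointAction d) (t : ℕ) (i : Fin N) (ω : Ω) : ℝ :=
  ∑ s ∈ Finset.Icc 1 t, ‖X s ω i - X (s + 1) ω i‖ ^ 2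

/-- The adaptive extrapolation step size
`γⁱ_t = (1 + ∑_{s=1}^{t-2} ‖gⁱ_s‖²)^{-(1/2 - q)}`. The sum is empty for `t ≤ 2`, which the
truncated subtraction `t - 2` renders. -/
def extrapStep (q : ℝ) (g : ℕ → (i : Fin N) → Ω → Action d i)
    (t : ℕ) (i : Fin N) (ω : Ω) : ℝ :=
  1 / (1 + cumSq g (t - 2) i ω) ^ (1 / 2 - q)

/-- The adaptive update step size
`ηⁱ_t = (1 + ∑_{s=1}^{t-2} (‖gⁱ_s‖² + ‖Xⁱ_s - Xⁱ_{s+1}‖²))^{-1/2}`, with the same convention. -/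
def updateStep (g : ℕ → (i : Fin N) → Ω → Action d i) (X : ℕ → Ω → JointAction d)
    (t : ℕ) (i : Fin N) (ω : Ω) : ℝ :=
  1 / √(1 + cumSq g (t - 2) i ω + pathSq X (t - 2) i ω)

/-- All players run OptDA+ with the adaptive step sizes: `X t` is `X_t`, `x t` is the action
`X_{t+1/2}` played at round `t`, and rounds are numbered from `1`. -/
structure RunsAdaptiveOptDAPlus (ℓ : Fin N → JointAction d → ℝ) (q : ℝ)
    (ξ : ℕ → (i : Fin N) → Ω → Action d i) (X x : ℕ → Ω → JointAction d) : Prop where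
  extrapolate : ∀ t : ℕ, 1 ≤ t → ∀ (i : Fin N) (ω : Ω),
    x t ω i = X t ω i - extrapStep q (feedback ℓ x ξ) t i ω • feedback ℓ x ξ (t - 1) i ω
  update : ∀ t : ℕ, 1 ≤ t → ∀ (i : Fin N) (ω : Ω),
    X (t + 1) ω i = X 1 ω i - updateStep (feedback ℓ x ξ) X (t + 1) i ω •
      ∑ s ∈ Finset.Icc 1 t, feedback ℓ x ξ s i ω

/-- The natural filtration of the played actions: the σ-algebra generated by `x_1, …, x_t`. -/
abbrev playHistory (x : ℕ → Ω → JointAction d) (t : ℕ) : MeasurableSpace Ω :=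
  ⨆ s ∈ Set.Icc 1 t, MeasurableSpace.comap (x s) (borel (JointAction d))

/-- Noise conditions: conditionally on `x_1, …, x_t`, the noise `ξⁱ_t` has zero mean and its
second moment is at most `σA² + σM² ‖Vⁱ(x_t)‖²`. -/
structure NoiseModel [MeasurableSpace Ω] (μ : Measure Ω) (ℓ : Fin N → JointAction d → ℝ)
    (x : ℕ → Ω → JointAction d) (ξ : ℕ → (i : Fin N) → Ω → Action d i) (σA σM : ℝ) : Prop where
  measurable : ∀ t : ℕ, 1 ≤ t → ∀ i : Fin N, Measurable (ξ t i)
  unbiased : ∀ t : ℕ, 1 ≤ t → ∀ i : Fin N, μ[ξ t i | playHistory x t] =ᵐ[μ] 0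
  variance : ∀ t : ℕ, 1 ≤ t → ∀ i : Fin N,
    μ[fun ω => ‖ξ t i ω‖ ^ 2 | playHistory x t] ≤ᵐ[μ]
      fun ω => σA ^ 2 + σM ^ 2 * ‖indivGrad ℓ i (x t ω)‖ ^ 2

/-- Bounded feedback: the individual gradients are bounded by `G` everywhere, and the noise is
almost surely bounded by `B`. -/
structure BoundedFeedback [MeasurableSpace Ω] (μ : Measure Ω) (ℓ : Fin N → JointAction d → ℝ)
    (ξ : ℕ → (i : Fin N) → Ω → Action d i) (G B : ℝ) : Prop where
  grad_le : ∀ (i : Fin N) (x : JointAction d), ‖indivGrad ℓ i x‖ ≤ G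
  noise_le : ∀ t : ℕ, 1 ≤ t → ∀ i : Fin N, ∀ᵐ ω ∂μ, ‖ξ t i ω‖ ≤ B

end Dynamics

end NoisyGame

end

namespace NoisyGame

/-! ### Real sequences -/

/-! For a Nash equilibrium `p`, the energy is `∑ᵢ ‖Xⁱ_t - pⁱ‖² / ηⁱ_t`. One step of dual averaging
(`dualAveraging_descent`) changes it by `-2⟨g_t, x_t - p⟩`, which has nonpositive conditional mean
by variational stability, by the correlation `-2γ_t⟨g_t, g_{t-1}⟩`, by a negative multiple of `‖X_t
- X_{t+1}‖²`, and by errors. The correlation is what makes optimism work: polarization of `⟨V(x_t),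
V(x_{t-1})⟩` produces the drift `-γ_t‖V(x_t)‖²` and the error `γ_t‖V(x_t) - V(x_{t-1})‖²`. The
remaining product of `V(x_t)` with the old noise `ξ_{t-1}` is not centered, as `x_t` depends on that
noise; comparing `V(x_t)` with `V` at the `denoised` action makes it centered up to `γ_t²‖ξ_{t-1}‖²`
(`cross_term_le`). Since `q ≤ 1/4`, errors of size `γ²‖g‖²` are at most `‖g‖²/√(1+λ)`, and their sum
is of order `√(1+λ_T)`.

Summing in expectation bounds `E[∑ γ‖V‖² + μ_T/4]` by a constant plus a multiple of `E√(1 + λ_T +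
μ_T)` (`exists_energy_le`). The loop closes because multiplicative noise gives `E ∑ γ‖g‖² ≤ (1+σ_M²)
E ∑ γ‖V‖²`, while pathwise `∑ γ‖g‖² ≥ (1+λ_T)^{1/2+q} - 1`, which dominates `√(1+λ_T)` since `q >
0`. Hence all these expectations are bounded uniformly in `T` (`exists_uniform_bound`), and by
monotone convergence `λ` and `μ` are almost surely bounded. The step sizes then have positive limits
and `∑‖V(x_t)‖²` is finite.

For each fixed equilibrium the energy is now an almost supermartingale with integrable total error,
so it converges almost surely (`ae_tendsto_weightedDist`). Gradients vanish along the iterates, and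
zeros of `V` are equilibria by convexity. Opial's argument over a countable dense set of equilibria
(`exists_tendsto_of_weighted_dist`) concludes. -/

theorem div_sqrt_le_sub {y a : ℝ} (hy : 0 < y) (ha : 0 ≤ a) :
    a / √(y + a) ≤ 2 * (√(y + a) - √y) := by
  have h1 : 0 < √(y + a) := Real.sqrt_pos.2 (by linarith)
  have h2 : √(y + a) ^ 2 = y + a := Real.sq_sqrt (by linarith)
  have h3 : √y ^ 2 = y := Real.sq_sqrt hy.le
  rw [div_le_iff₀ h1]
  nlinarith [sq_nonneg (√(y + a) - √y)]

theorem sum_Icc_mono {a : ℕ → ℝ} (ha : ∀ t, 0 ≤ a t) {s t : ℕ} (hst : s ≤ t) :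
    ∑ k ∈ Finset.Icc 1 s, a k ≤ ∑ k ∈ Finset.Icc 1 t, a k :=
  Finset.sum_le_sum_of_subset_of_nonneg (Finset.Icc_subset_Icc le_rfl hst) fun k _ _ => ha k

/-- Adaptive step sizes with a delay of two rounds still telescope, for bounded increments. -/
theorem sum_div_sqrt_delayed_le {a : ℕ → ℝ} {M : ℝ} (ha : ∀ t, 0 ≤ a t) (haM : ∀ t, a t ≤ M)
    (T : ℕ) :
    ∑ t ∈ Finset.Icc 1 T, a t / √(1 + ∑ s ∈ Finset.Icc 1 (t - 2), a s) ≤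
      2 * √(1 + 2 * M) * √(1 + ∑ s ∈ Finset.Icc 1 T, a s) := by
  have hM : 0 ≤ M := (ha 0).trans (haM 0)
  have hS : ∀ t, 0 ≤ ∑ s ∈ Finset.Icc 1 t, a s := fun t => Finset.sum_nonneg fun s _ => ha s
  -- The delay omits at most two increments, so `1 + S_t ≤ (1 + 2M)(1 + S_{t-2})`; this is the
  -- source of the factor `√(1 + 2M)`.
  have hdelay : ∀ t, ∑ s ∈ Finset.Icc 1 t, a s ≤ (∑ s ∈ Finset.Icc 1 (t - 2), a s) + 2 * M := by
    intro t
    match t with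
    | 0 => simp; linarith
    | 1 => simp; linarith [haM 1]
    | t + 2 =>
      rw [Finset.sum_Icc_succ_top (by omega), Finset.sum_Icc_succ_top (by omega),
        Nat.add_sub_cancel]
      linarith [haM (t + 1), haM (t + 1 + 1)]
  have hterm : ∀ t, a t / √(1 + ∑ s ∈ Finset.Icc 1 (t - 2), a s) ≤
      √(1 + 2 * M) * (a t / √(1 + ∑ s ∈ Finset.Icc 1 t, a s)) := by
    intro t
    have h0 := hS t
    have h1 := hS (t - 2)
    have key : √(1 + ∑ s ∈ Finset.Icc 1 t, a s) ≤
        √(1 + 2 * M) * √(1 + ∑ s ∈ Finset.Icc 1 (t - 2), a s) := by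
      rw [← Real.sqrt_mul (by positivity)]
      apply Real.sqrt_le_sqrt
      nlinarith [hdelay t]
    have p0 : 0 < √(1 + ∑ s ∈ Finset.Icc 1 t, a s) := Real.sqrt_pos.2 (by linarith)
    have p1 : 0 < √(1 + ∑ s ∈ Finset.Icc 1 (t - 2), a s) := Real.sqrt_pos.2 (by linarith)
    rw [mul_div_assoc', div_le_div_iff₀ p1 p0]
    nlinarith [ha t, mul_le_mul_of_nonneg_left key (ha t)]
  refine (Finset.sum_le_sum fun t _ => hterm t).trans ?_
  rw [← Finset.mul_sum, mul_comm 2 √(1 + 2 * M), mul_assoc]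
  refine mul_le_mul_of_nonneg_left ?_ (Real.sqrt_nonneg _)
  induction T with
  | zero => simp
  | succ T ih =>
    rw [Finset.sum_Icc_succ_top (by omega)]
    have := div_sqrt_le_sub (y := 1 + ∑ s ∈ Finset.Icc 1 T, a s) (by linarith [hS T]) (ha (T + 1))
    rw [Finset.sum_Icc_succ_top (by omega : 1 ≤ T + 1) a, ← add_assoc]
    linarith

/-- The negative drift `-a_t √(1 + ∑_{s ≤ t-2} a_s) / 2` absorbs a truncated linear term. -/
theorem sum_min_sub_le {a : ℕ → ℝ} {A K : ℝ} (ha : ∀ t, 0 ≤ a t) (hA : 0 ≤ A) (hK : 0 ≤ K)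
    (T : ℕ) :
    ∑ t ∈ Finset.Icc 1 T,
      (min A (K * a t) - a t * √(1 + ∑ s ∈ Finset.Icc 1 (t - 2), a s) / 2) ≤
      4 * K ^ 3 + 2 * A := by
  have hS : ∀ t, 0 ≤ ∑ s ∈ Finset.Icc 1 t, a s := fun t => Finset.sum_nonneg fun s _ => ha s
  have hA' : ∀ t, min A (K * a t) - a t * √(1 + ∑ s ∈ Finset.Icc 1 (t - 2), a s) / 2 ≤ A := by
    intro t
    have := min_le_left A (K * a t)
    have : 0 ≤ a t * √(1 + ∑ s ∈ Finset.Icc 1 (t - 2), a s) := mul_nonneg (ha t) (by positivity)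
    linarith
  have hK' : ∀ t, min A (K * a t) - a t * √(1 + ∑ s ∈ Finset.Icc 1 (t - 2), a s) / 2 ≤
      K * a t := by
    intro t
    have := min_le_right A (K * a t)
    have : 0 ≤ a t * √(1 + ∑ s ∈ Finset.Icc 1 (t - 2), a s) := mul_nonneg (ha t) (by positivity)
    linarith
  have hK3 : 0 ≤ K ^ 3 := by positivity
  induction T with
  | zero => simp; positivity
  | succ T ih =>
    -- While the delayed sum is at most `4K²`, the linear bound costs at most `K · 4K²`, and the two
    -- newest rounds, invisible to that sum, cost at most `A` each. Beyond `4K²` the root exceeds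
    -- `2K` and the new term is nonpositive.
    by_cases hc : ∑ s ∈ Finset.Icc 1 (T - 1), a s ≤ 4 * K ^ 2
    · have hlin : ∑ t ∈ Finset.Icc 1 (T - 1),
          (min A (K * a t) - a t * √(1 + ∑ s ∈ Finset.Icc 1 (t - 2), a s) / 2) ≤ 4 * K ^ 3 := by
        refine (Finset.sum_le_sum fun t _ => hK' t).trans ?_
        rw [← Finset.mul_sum]
        nlinarith
      match T with
      | 0 =>
        rw [Finset.sum_Icc_succ_top (by omega)]
        simp only [zero_lt_one, Finset.Icc_eq_empty_of_lt, Finset.sum_empty]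
        linarith [hA' (0 + 1)]
      | T + 1 =>
        rw [Finset.sum_Icc_succ_top (by omega), Finset.sum_Icc_succ_top (by omega)]
        simp only [Nat.add_sub_cancel] at hlin
        linarith [hA' (T + 1), hA' (T + 1 + 1)]
    · rw [Finset.sum_Icc_succ_top (by omega)]
      have h2 : 2 * K ≤ √(1 + ∑ s ∈ Finset.Icc 1 (T + 1 - 2), a s) := by
        apply Real.le_sqrt_of_sq_le
        rw [show T + 1 - 2 = T - 1 by omega]
        nlinarith
      have := min_le_right A (K * a (T + 1))
      have := mul_le_mul_of_nonneg_left h2 (ha (T + 1))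
      linarith

/-- Every weight is at least the undelayed final weight `Λ^{-(1/2-q)}`, and `(Λ - 1) Λ^{-(1/2-q)} ≥
Λ^{1/2+q} - 1`. This is the growth that beats the `√λ` of the regret bound. -/
theorem rpow_sub_one_le_sum {a : ℕ → ℝ} {q : ℝ} (ha : ∀ t, 0 ≤ a t) (hq : q ≤ 1 / 2) (T : ℕ) :
    (1 + ∑ s ∈ Finset.Icc 1 T, a s) ^ (1 / 2 + q) - 1 ≤
      ∑ t ∈ Finset.Icc 1 T, 1 / (1 + ∑ s ∈ Finset.Icc 1 (t - 2), a s) ^ (1 / 2 - q) * a t := by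
  have hS : ∀ t, 0 ≤ ∑ s ∈ Finset.Icc 1 t, a s := fun t => Finset.sum_nonneg fun s _ => ha s
  set Λ := 1 + ∑ s ∈ Finset.Icc 1 T, a s with hΛ
  have hΛ1 : 1 ≤ Λ := by linarith [hS T]
  have hpos : 0 < Λ ^ (1 / 2 - q) := Real.rpow_pos_of_pos (by linarith) _
  have hge : 1 ≤ Λ ^ (1 / 2 - q) := Real.one_le_rpow hΛ1 (by linarith)
  calc Λ ^ (1 / 2 + q) - 1 ≤ 1 / Λ ^ (1 / 2 - q) * (Λ - 1) := by
        have : Λ ^ (1 / 2 + q) = Λ / Λ ^ (1 / 2 - q) := by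
          rw [eq_div_iff hpos.ne', ← Real.rpow_add (by linarith)]
          norm_num
        rw [this, mul_sub, mul_one, div_mul_eq_mul_div, one_mul]
        have : 1 / Λ ^ (1 / 2 - q) ≤ 1 := by rw [div_le_one hpos]; exact hge
        linarith
    _ = ∑ t ∈ Finset.Icc 1 T, 1 / Λ ^ (1 / 2 - q) * a t := by
        rw [← Finset.mul_sum, hΛ]; ring
    _ ≤ _ := by
        refine Finset.sum_le_sum fun t ht => mul_le_mul_of_nonneg_right ?_ (ha t)
        have h1 := hS (t - 2)
        refine one_div_le_one_div_of_le (Real.rpow_pos_of_pos (by linarith) _) ?_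
        refine Real.rpow_le_rpow (by linarith) ?_ (by linarith)
        have := sum_Icc_mono ha (show t - 2 ≤ T by have := (Finset.mem_Icc.1 ht).2; omega)
        linarith

theorem exists_sqrt_le_rpow {q ε : ℝ} (hq : 0 < q) (hε : 0 < ε) :
    ∃ C : ℝ, 0 ≤ C ∧ ∀ y : ℝ, 1 ≤ y → √y ≤ ε * y ^ (1 / 2 + q) + C := by
  refine ⟨√((1 / ε) ^ (1 / q)), Real.sqrt_nonneg _, fun y hy => ?_⟩
  have hy0 : 0 < y := by linarith
  by_cases h : 1 / ε ≤ y ^ q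
  · have h1 : √y * (1 / ε) ≤ √y * y ^ q := mul_le_mul_of_nonneg_left h (Real.sqrt_nonneg _)
    rw [mul_one_div, div_le_iff₀ hε, Real.sqrt_eq_rpow, ← Real.rpow_add hy0] at h1
    rw [Real.sqrt_eq_rpow]
    linarith [Real.sqrt_nonneg ((1 / ε) ^ (1 / q))]
  · push Not at h
    have h1 : y ≤ (1 / ε) ^ (1 / q) := by
      have := Real.rpow_le_rpow (Real.rpow_nonneg hy0.le q) h.le (by positivity : 0 ≤ 1 / q)
      rwa [← Real.rpow_mul hy0.le, mul_one_div_cancel hq.ne', Real.rpow_one] at this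
    have := Real.sqrt_le_sqrt h1
    have : 0 ≤ ε * y ^ (1 / 2 + q) := by positivity
    linarith

theorem sqrt_le_mul_add {ε m : ℝ} (hε : 0 < ε) (hm : 0 ≤ m) : √m ≤ ε * m + 1 / ε := by
  have h1 : √m ^ 2 = m := Real.sq_sqrt hm
  have h2 : ε * √m ≤ ε * (ε * m + 1 / ε) := by
    have h3 : ε * (ε * m) = (ε * √m) ^ 2 := by rw [mul_pow, h1]; ring
    rw [mul_add, mul_one_div_cancel hε.ne', h3]
    nlinarith [sq_nonneg (ε * √m - 1 / 2)]
  exact le_of_mul_le_mul_left h2 hε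

theorem min_sum_le {ι : Type*} (s : Finset ι) {A : ℝ} (hA : 0 ≤ A) {b : ι → ℝ}
    (hb : ∀ j, 0 ≤ b j) : min A (∑ j ∈ s, b j) ≤ ∑ j ∈ s, min A (b j) := by
  classical
  induction s using Finset.induction_on with
  | empty => simp
  | insert j s hj ih =>
    rw [Finset.sum_insert hj, Finset.sum_insert hj]
    have h0 : 0 ≤ ∑ j ∈ s, b j := Finset.sum_nonneg fun j _ => hb j
    have h1 : 0 ≤ ∑ j ∈ s, min A (b j) := Finset.sum_nonneg fun j _ => le_min hA (hb j)
    have := hb j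
    rcases le_total A (b j) with h | h
    · rw [min_eq_left h]
      linarith [min_le_left A (b j + ∑ j ∈ s, b j)]
    · rw [min_eq_right h]
      rcases le_total A (∑ j ∈ s, b j) with h' | h'
      · rw [min_eq_left h'] at ih
        linarith [min_le_left A (b j + ∑ j ∈ s, b j)]
      · rw [min_eq_right h'] at ih
        linarith [min_le_right A (b j + ∑ j ∈ s, b j)]

/-! ### Inner product estimates -/

section Inner

variable {E : Type*} [NormedAddCommGroup E] [InnerProductSpace ℝ E]

/-- One step of dual averaging with a non-increasing step size. -/
theorem dualAveraging_descent {x₁ p S g : E} {η η' : ℝ} (hη' : 0 < η') (hle : η' ≤ η) :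
    ‖x₁ - η' • (S + g) - p‖ ^ 2 / η' ≤ ‖x₁ - η • S - p‖ ^ 2 / η +
      (1 / η' - 1 / η) * ‖x₁ - p‖ ^ 2 - 2 * inner ℝ g (x₁ - η' • (S + g) - p) -
      ‖(x₁ - η • S) - (x₁ - η' • (S + g))‖ ^ 2 / η := by
  have hη : 0 < η := hη'.trans_le hle
  obtain ⟨a, rfl⟩ : ∃ a, x₁ = a + p := ⟨x₁ - p, by simp⟩
  have e1 : a + p - η' • (S + g) - p = a - η' • (S + g) := by abel
  have e2 : a + p - η • S - p = a - η • S := by abel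
  have e3 : a + p - η • S - (a + p - η' • (S + g)) = η' • (S + g) - η • S := by abel
  rw [e1, e2, e3, add_sub_cancel_right]
  obtain ⟨S', rfl⟩ : ∃ S', g = S' - S := ⟨S + g, by simp⟩
  rw [add_sub_cancel]
  simp only [@norm_sub_sq_real, inner_sub_left, inner_sub_right, norm_smul, inner_smul_left,
    inner_smul_right, mul_pow, Real.norm_eq_abs, sq_abs, RCLike.conj_to_real,
    real_inner_self_eq_norm_sq]
  rw [real_inner_comm S' a, real_inner_comm S a, real_inner_comm S' S]
  -- After expansion, the right side minus the left side is exactly this quantity.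
  have key : 0 ≤ η' * ‖S'‖ ^ 2 * (1 - η' / η) := by
    have : η' / η ≤ 1 := (div_le_one hη).2 hle
    have : 0 ≤ 1 - η' / η := by linarith
    positivity
  rw [← sub_nonneg]
  convert key using 1
  field_simp
  ring

theorem inner_young {a b : E} {c : ℝ} (hc : 0 < c) :
    2 * inner ℝ a b ≤ c * ‖a‖ ^ 2 + ‖b‖ ^ 2 / c := by
  have h := real_inner_le_norm a b
  have h2 : c * (2 * (‖a‖ * ‖b‖)) ≤ c * (c * ‖a‖ ^ 2 + ‖b‖ ^ 2 / c) := by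
    rw [mul_add, mul_div_cancel₀ _ hc.ne']
    nlinarith [sq_nonneg (c * ‖a‖ - ‖b‖)]
  linarith [le_of_mul_le_mul_left h2 hc]

end Inner

theorem norm_add_add_sq_le {E : Type*} [SeminormedAddCommGroup E] (a b c : E) :
    ‖a + b + c‖ ^ 2 ≤ 3 * (‖a‖ ^ 2 + ‖b‖ ^ 2 + ‖c‖ ^ 2) := by
  have h : ‖a + b + c‖ ≤ ‖a‖ + ‖b‖ + ‖c‖ := norm_add₃_le
  have h2 : ‖a + b + c‖ ^ 2 ≤ (‖a‖ + ‖b‖ + ‖c‖) ^ 2 := pow_le_pow_left₀ (norm_nonneg _) h 2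
  nlinarith [sq_nonneg (‖a‖ - ‖b‖), sq_nonneg (‖b‖ - ‖c‖), sq_nonneg (‖a‖ - ‖c‖)]

/-- A convex differentiable function is minimal at its critical points. -/
theorem ConvexOn.le_of_gradient_eq_zero {E : Type*} [NormedAddCommGroup E]
    [InnerProductSpace ℝ E] [CompleteSpace E] {f : E → ℝ} (hf : ConvexOn ℝ Set.univ f) {a : E}
    (hd : DifferentiableAt ℝ f a) (h0 : gradient f a = 0) (y : E) : f a ≤ f y := by
  have hg : HasGradientAt f 0 a := h0 ▸ hd.hasGradientAt
  have hline : ConvexOn ℝ Set.univ (f ∘ AffineMap.lineMap (k := ℝ) a y) := by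
    simpa using hf.comp_affineMap (AffineMap.lineMap (k := ℝ) a y)
  have hder : HasDerivAt (f ∘ AffineMap.lineMap (k := ℝ) a y) 0 0 := by
    have h1 : HasFDerivAt f (0 : E →L[ℝ] ℝ) (AffineMap.lineMap (k := ℝ) a y (0 : ℝ)) := by
      simpa using hg.hasFDerivAt
    simpa using h1.comp_hasDerivAt (0 : ℝ) (AffineMap.hasDerivAt_lineMap (a := a) (b := y))
  have := hline.le_slope_of_hasDerivAt (Set.mem_univ 0) (Set.mem_univ 1) zero_lt_one hder
  simpa [slope_def_field] using this

/-! ### Bounded measurable maps -/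

section BddMeas

variable {Ω : Type*} {m m0 : MeasurableSpace Ω} {μ : Measure Ω}

/-- Strongly `m`-measurable and almost surely bounded. -/
structure BddMeas {E : Type*} [NormedAddCommGroup E] (m : MeasurableSpace Ω)
    {m0 : MeasurableSpace Ω} (μ : Measure Ω) (f : Ω → E) : Prop where
  meas : StronglyMeasurable[m] f
  bdd : ∃ C : ℝ, ∀ᵐ ω ∂μ, ‖f ω‖ ≤ C

namespace BddMeas

variable {E F : Type*} [NormedAddCommGroup E] [NormedAddCommGroup F]

theorem mono {m' : MeasurableSpace Ω} {f : Ω → E} (hf : BddMeas m μ f) (h : m ≤ m') :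
    BddMeas m' μ f :=
  ⟨hf.meas.mono h, hf.bdd⟩

theorem integrable [IsFiniteMeasure μ] {f : Ω → E} (hf : BddMeas m μ f) (h : m ≤ m0) :
    Integrable f μ := by
  obtain ⟨C, hC⟩ := hf.bdd
  exact Integrable.of_bound (hf.meas.mono h).aestronglyMeasurable C hC

theorem const (c : E) : BddMeas m μ (fun _ : Ω => c) :=
  ⟨stronglyMeasurable_const, ‖c‖, ae_of_all _ fun _ => le_rfl⟩

theorem add {f g : Ω → E} (hf : BddMeas m μ f) (hg : BddMeas m μ g) :
    BddMeas m μ (fun ω => f ω + g ω) := by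
  obtain ⟨C, hC⟩ := hf.bdd
  obtain ⟨D, hD⟩ := hg.bdd
  refine ⟨hf.meas.add hg.meas, C + D, ?_⟩
  filter_upwards [hC, hD] with ω h1 h2 using (norm_add_le _ _).trans (add_le_add h1 h2)

theorem neg {f : Ω → E} (hf : BddMeas m μ f) : BddMeas m μ (fun ω => -f ω) := by
  obtain ⟨C, hC⟩ := hf.bdd
  exact ⟨hf.meas.neg, C, by simpa using hC⟩

theorem sub {f g : Ω → E} (hf : BddMeas m μ f) (hg : BddMeas m μ g) :
    BddMeas m μ (fun ω => f ω - g ω) := by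
  simpa only [sub_eq_add_neg] using hf.add hg.neg

theorem sum {ι : Type*} (s : Finset ι) {f : ι → Ω → E} (hf : ∀ i ∈ s, BddMeas m μ (f i)) :
    BddMeas m μ (fun ω => ∑ i ∈ s, f i ω) := by
  classical
  induction s using Finset.induction_on with
  | empty => simpa using const (0 : E)
  | insert a s ha ih =>
    simp only [Finset.sum_insert ha]
    exact (hf a (Finset.mem_insert_self _ _)).add
      (ih fun i hi => hf i (Finset.mem_insert_of_mem hi))

theorem smul [NormedSpace ℝ E] {c : Ω → ℝ} {f : Ω → E} (hc : BddMeas m μ c)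
    (hf : BddMeas m μ f) : BddMeas m μ (fun ω => c ω • f ω) := by
  obtain ⟨C, hC⟩ := hc.bdd
  obtain ⟨D, hD⟩ := hf.bdd
  refine ⟨hc.meas.smul hf.meas, C * D, ?_⟩
  filter_upwards [hC, hD] with ω h1 h2
  rw [norm_smul]
  exact mul_le_mul h1 h2 (norm_nonneg _) ((norm_nonneg _).trans h1)

theorem mul {c f : Ω → ℝ} (hc : BddMeas m μ c) (hf : BddMeas m μ f) :
    BddMeas m μ (fun ω => c ω * f ω) := hc.smul hf

/-- Composition with a continuous map on a proper space. -/
theorem comp_continuous [ProperSpace E] {φ : E → F} (hφ : Continuous φ) {f : Ω → E}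
    (hf : BddMeas m μ f) : BddMeas m μ (fun ω => φ (f ω)) := by
  obtain ⟨C, hC⟩ := hf.bdd
  obtain ⟨D, hD⟩ := (isCompact_closedBall (0 : E) C).exists_bound_of_continuousOn hφ.continuousOn
  refine ⟨hφ.comp_stronglyMeasurable hf.meas, D, ?_⟩
  filter_upwards [hC] with ω h using hD _ (by simpa using h)

theorem norm {f : Ω → E} (hf : BddMeas m μ f) : BddMeas m μ (fun ω => ‖f ω‖) := by
  obtain ⟨C, hC⟩ := hf.bdd
  exact ⟨hf.meas.norm, C, by simpa using hC⟩

theorem pow {f : Ω → ℝ} (hf : BddMeas m μ f) (n : ℕ) : BddMeas m μ (fun ω => f ω ^ n) :=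
  hf.comp_continuous (continuous_pow n)

theorem sqrt {f : Ω → ℝ} (hf : BddMeas m μ f) : BddMeas m μ (fun ω => √(f ω)) :=
  hf.comp_continuous Real.continuous_sqrt

theorem norm_sq {f : Ω → E} (hf : BddMeas m μ f) : BddMeas m μ (fun ω => ‖f ω‖ ^ 2) :=
  hf.norm.pow 2

theorem min {f g : Ω → ℝ} (hf : BddMeas m μ f) (hg : BddMeas m μ g) :
    BddMeas m μ (fun ω => min (f ω) (g ω)) := by
  have h : ∀ ω, Min.min (f ω) (g ω) = (1 / 2 : ℝ) * (f ω + g ω - ‖f ω - g ω‖) := fun ω => by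
    have := max_add_min (f ω) (g ω)
    have := max_sub_min_eq_abs (f ω) (g ω)
    rw [Real.norm_eq_abs, abs_sub_comm]
    linarith
  simp only [h]
  exact (const _).mul ((hf.add hg).sub (hf.sub hg).norm)

theorem inner [InnerProductSpace ℝ E] {f g : Ω → E} (hf : BddMeas m μ f) (hg : BddMeas m μ g) :
    BddMeas m μ (fun ω => inner ℝ (f ω) (g ω)) := by
  obtain ⟨C, hC⟩ := hf.bdd
  obtain ⟨D, hD⟩ := hg.bdd
  refine ⟨hf.meas.inner hg.meas, C * D, ?_⟩
  filter_upwards [hC, hD] with ω h1 h2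
  exact (norm_inner_le_norm _ _).trans
    (mul_le_mul h1 h2 (norm_nonneg _) ((norm_nonneg _).trans h1))

end BddMeas

end BddMeas

/-! ### Conditional expectations and convergence -/

/-- A monotone sequence of nonnegative functions with bounded integrals is almost surely
bounded. -/
theorem ae_bddAbove_of_integral_le {Ω : Type*} {m0 : MeasurableSpace Ω} {μ : Measure Ω}
    {f : ℕ → Ω → ℝ} {C : ℝ} (hI : ∀ n, Integrable (f n) μ)
    (h0 : ∀ n ω, 0 ≤ f n ω) (hmono : ∀ ω, Monotone fun n => f n ω)
    (hC : ∀ n, ∫ ω, f n ω ∂μ ≤ C) : ∀ᵐ ω ∂μ, BddAbove (Set.range fun n => f n ω) := by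
  have hlint : ∫⁻ ω, ⨆ n, ENNReal.ofReal (f n ω) ∂μ ≤ ENNReal.ofReal C := by
    rw [lintegral_iSup' (fun n => (hI n).aemeasurable.ennreal_ofReal)
      (ae_of_all _ fun ω a b hab => ENNReal.ofReal_le_ofReal (hmono ω hab))]
    refine iSup_le fun n => ?_
    rw [← ofReal_integral_eq_lintegral_ofReal (hI n) (ae_of_all _ (h0 n))]
    exact ENNReal.ofReal_le_ofReal (hC n)
  have hfin := ae_lt_top' (AEMeasurable.iSup fun n => (hI n).aemeasurable.ennreal_ofReal)
    (hlint.trans_lt ENNReal.ofReal_lt_top).ne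
  filter_upwards [hfin] with ω hω
  refine ⟨(⨆ n, ENNReal.ofReal (f n ω)).toReal, ?_⟩
  rintro _ ⟨n, rfl⟩
  rw [← ENNReal.ofReal_le_iff_le_toReal hω.ne]
  exact le_iSup (fun n => ENNReal.ofReal (f n ω)) n

section Probability

variable {Ω : Type*} {m m0 : MeasurableSpace Ω} {μ : Measure Ω} [IsProbabilityMeasure μ]

/-- An `m`-measurable factor comes out of the conditional expectation, leaving the inner product
with `μ[ζ | m] = 0`. -/
theorem condExp_inner_eq_zero {E : Type*} [NormedAddCommGroup E] [InnerProductSpace ℝ E]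
    [CompleteSpace E] (hm : m ≤ m0) {ζ Y : Ω → E} (hζ : BddMeas m0 μ ζ)
    (hζ0 : μ[ζ | m] =ᵐ[μ] 0) (hY : BddMeas m μ Y) :
    μ[fun ω => inner ℝ (ζ ω) (Y ω) | m] =ᵐ[μ] 0 := by
  have h : μ[fun ω => inner ℝ (ζ ω) (Y ω) | m] =ᵐ[μ] fun ω => inner ℝ (μ[ζ | m] ω) (Y ω) :=
    condExp_bilin_of_stronglyMeasurable_right (μ := μ) (innerSL ℝ (E := E)) hY.meas
      ((hζ.inner (hY.mono hm)).integrable le_rfl) (hζ.integrable le_rfl)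
  filter_upwards [h, hζ0] with ω h1 h2
  rw [h1, h2]
  simp

theorem integral_inner_eq_zero {E : Type*} [NormedAddCommGroup E] [InnerProductSpace ℝ E]
    [CompleteSpace E] (hm : m ≤ m0) {ζ Y : Ω → E} (hζ : BddMeas m0 μ ζ)
    (hζ0 : μ[ζ | m] =ᵐ[μ] 0) (hY : BddMeas m μ Y) :
    ∫ ω, inner ℝ (ζ ω) (Y ω) ∂μ = 0 := by
  rw [← integral_condExp hm, integral_congr_ae (condExp_inner_eq_zero hm hζ hζ0 hY)]
  simp

theorem integral_mul_le_of_condExp_le (hm : m ≤ m0) {f h w : Ω → ℝ} (hf : BddMeas m0 μ f)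
    (hh : BddMeas m μ h) (hw : BddMeas m μ w) (hw0 : ∀ ω, 0 ≤ w ω) (hle : μ[f | m] ≤ᵐ[μ] h) :
    ∫ ω, w ω * f ω ∂μ ≤ ∫ ω, w ω * h ω ∂μ := by
  have hpull : μ[fun ω => w ω * f ω | m] =ᵐ[μ] fun ω => w ω * μ[f | m] ω :=
    condExp_mul_of_stronglyMeasurable_left hw.meas (((hw.mono hm).mul hf).integrable le_rfl)
      (hf.integrable le_rfl)
  rw [← integral_condExp hm]
  refine integral_mono_ae integrable_condExp ((hw.mul hh).integrable hm) ?_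
  filter_upwards [hpull, hle] with ω h1 h2
  rw [h1]
  exact mul_le_mul_of_nonneg_left h2 (hw0 ω)

/-- Almost supermartingales with integrable total error converge: the Robbins–Siegmund
theorem for bounded increments. -/
theorem ae_tendsto_of_almost_supermartingale (ℱ : Filtration ℕ m0) {u b v : ℕ → Ω → ℝ} {C : ℝ}
    (hu : ∀ n, BddMeas (ℱ n) μ (u n)) (hb : ∀ n, BddMeas (ℱ (n + 1)) μ (b n))
    (hv : ∀ n, BddMeas m0 μ (v n))
    (hu0 : ∀ n ω, 0 ≤ u n ω) (hb0 : ∀ n ω, 0 ≤ b n ω)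
    (hstep : ∀ n, ∀ᵐ ω ∂μ, u (n + 1) ω ≤ u n ω + b n ω - v n ω)
    (hv0 : ∀ n, 0 ≤ᵐ[μ] μ[v n | ℱ n])
    (hC : ∀ n, ∫ ω, ∑ k ∈ Finset.range n, b k ω ∂μ ≤ C) :
    ∀ᵐ ω ∂μ, ∃ l, Tendsto (fun n => u n ω) atTop (𝓝 l) := by
  have hbsum : ∀ n, BddMeas (ℱ n) μ (fun ω => ∑ k ∈ Finset.range n, b k ω) := fun n =>
    BddMeas.sum _ fun k hk => (hb k).mono (ℱ.mono (Finset.mem_range.1 hk))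
  have hMmeas : ∀ n, BddMeas (ℱ n) μ (fun ω => u n ω - ∑ k ∈ Finset.range n, b k ω) :=
    fun n => (hu n).sub (hbsum n)
  -- Subtracting the accumulated errors turns the almost supermartingale into a genuine
  -- supermartingale.
  set M : ℕ → Ω → ℝ := fun n ω => u n ω - ∑ k ∈ Finset.range n, b k ω with hM
  have hMint : ∀ n, Integrable (M n) μ := fun n => (hMmeas n).integrable (ℱ.le n)
  have hsuper : Supermartingale M ℱ μ := by
    refine supermartingale_nat (fun n => (hMmeas n).meas) hMint fun n => ?_
    have hle : M (n + 1) ≤ᵐ[μ] M n - v n := by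
      filter_upwards [hstep n] with ω h
      simp only [hM, Pi.sub_apply, Finset.sum_range_succ]
      linarith
    have h1 := condExp_mono (m := ℱ n) (hMint (n + 1))
      ((hMint n).sub ((hv n).integrable le_rfl)) hle
    have h2 := condExp_sub (hMint n) ((hv n).integrable le_rfl) (ℱ n)
    have h3 := condExp_of_stronglyMeasurable (ℱ.le n) (hMmeas n).meas (hMint n)
    filter_upwards [h1, h2, hv0 n] with ω h1 h2 h4
    rw [h2, Pi.sub_apply, h3] at h1
    simp only [Pi.zero_apply] at h4
    linarith
  have hbint : ∀ n, Integrable (fun ω => ∑ k ∈ Finset.range n, b k ω) μ := fun n =>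
    (hbsum n).integrable (ℱ.le n)
  have hbs0 : ∀ n ω, 0 ≤ ∑ k ∈ Finset.range n, b k ω := fun n ω =>
    Finset.sum_nonneg fun k _ => hb0 k ω
  -- Since `u ≥ 0`, `|M| ≤ u + ∑ b = M + 2 ∑ b`, and `∫ M_n ≤ ∫ M_0`; this is the `L¹` bound needed
  -- for Doob's convergence theorem.
  have hnorm : ∀ n, ∫ ω, ‖(-M) n ω‖ ∂μ ≤ ∫ ω, M 0 ω ∂μ + 2 * C := by
    intro n
    calc ∫ ω, ‖(-M) n ω‖ ∂μ
        ≤ ∫ ω, (M n ω + 2 * ∑ k ∈ Finset.range n, b k ω) ∂μ := by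
          refine integral_mono (hMint n).neg.norm ((hMint n).add ((hbint n).const_mul 2))
            fun ω => ?_
          simp only [Pi.neg_apply, norm_neg, Real.norm_eq_abs]
          rw [abs_le]
          have := hu0 n ω
          have := hbs0 n ω
          constructor <;> simp only [hM] <;> linarith
      _ = ∫ ω, M n ω ∂μ + 2 * ∫ ω, ∑ k ∈ Finset.range n, b k ω ∂μ := by
          rw [integral_add (hMint n) ((hbint n).const_mul 2), integral_const_mul]
      _ ≤ _ := by
          have h1 := hsuper.setIntegral_le (Nat.zero_le n) (s := Set.univ) MeasurableSet.univ
          simp only [Measure.restrict_univ] at h1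
          linarith [hC n]
  have hconv := hsuper.neg.exists_ae_tendsto_of_bdd
    (R := (∫ ω, M 0 ω ∂μ + 2 * C).toNNReal) (fun n => by
      rw [eLpNorm_one_eq_lintegral_enorm, Pi.neg_apply, ← ofReal_integral_norm_eq_lintegral_enorm
        (hMint n).neg]
      exact ENNReal.ofReal_le_ofReal (hnorm n))
  have hmono : ∀ ω, Monotone fun n => ∑ k ∈ Finset.range n, b k ω := fun ω =>
    monotone_nat_of_le_succ fun n => by
      rw [Finset.sum_range_succ]; linarith [hb0 n ω]
  have hbb := ae_bddAbove_of_integral_le hbint hbs0 hmono hC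
  filter_upwards [hconv, hbb] with ω h1 h2
  obtain ⟨l, hl⟩ := h1
  refine ⟨_, ((tendsto_atTop_ciSup (hmono ω) h2).sub hl).congr fun n => ?_⟩
  simp [hM]

end Probability

/-! ### Step sizes -/

section StepSizes

variable {N : ℕ} {d : Fin N → ℕ} {Ω : Type*} {g : ℕ → (i : Fin N) → Ω → Action d i}
  {X : ℕ → Ω → JointAction d} {q : ℝ} {t : ℕ} {i : Fin N} {ω : Ω}

/-- The inverse of `updateStep`. -/
noncomputable def invStep (g : ℕ → (i : Fin N) → Ω → Action d i) (X : ℕ → Ω → JointAction d)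
    (t : ℕ) (i : Fin N) (ω : Ω) : ℝ :=
  √(1 + cumSq g (t - 2) i ω + pathSq X (t - 2) i ω)

/-- The normalized squared feedback `‖gⁱ_t‖² / (1 + ∑_{s=1}^{t-2} ‖gⁱ_s‖²)^{1/2}`. -/
noncomputable def normalizedSq (g : ℕ → (i : Fin N) → Ω → Action d i) (t : ℕ) (i : Fin N)
    (ω : Ω) : ℝ :=
  ‖g t i ω‖ ^ 2 / √(1 + cumSq g (t - 2) i ω)

theorem cumSq_nonneg : 0 ≤ cumSq g t i ω := Finset.sum_nonneg fun _ _ => by positivity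

theorem pathSq_nonneg : 0 ≤ pathSq X t i ω := Finset.sum_nonneg fun _ _ => by positivity

theorem cumSq_mono : Monotone fun t => cumSq g t i ω := fun _ _ h =>
  sum_Icc_mono (a := fun s => ‖g s i ω‖ ^ 2) (fun _ => by positivity) h

theorem pathSq_mono : Monotone fun t => pathSq X t i ω := fun _ _ h =>
  sum_Icc_mono (a := fun s => ‖X s ω i - X (s + 1) ω i‖ ^ 2) (fun _ => by positivity) h

theorem updateStep_eq : updateStep g X t i ω = 1 / invStep g X t i ω := rfl

theorem one_le_invStep : 1 ≤ invStep g X t i ω := by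
  rw [invStep, Real.one_le_sqrt]
  linarith [cumSq_nonneg (g := g) (t := t - 2) (i := i) (ω := ω),
    pathSq_nonneg (X := X) (t := t - 2) (i := i) (ω := ω)]

theorem invStep_pos : 0 < invStep g X t i ω := zero_lt_one.trans_le one_le_invStep

theorem invStep_mono : Monotone fun t => invStep g X t i ω := fun s t h => by
  have h' : s - 2 ≤ t - 2 := Nat.sub_le_sub_right h 2
  have h1 := cumSq_mono (g := g) (i := i) (ω := ω) h'
  have h2 := pathSq_mono (X := X) (i := i) (ω := ω) h'
  exact Real.sqrt_le_sqrt (by simp only at h1 h2; linarith)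

theorem sqrt_pathSq_le_invStep : √(1 + pathSq X (t - 2) i ω) ≤ invStep g X t i ω :=
  Real.sqrt_le_sqrt (by linarith [cumSq_nonneg (g := g) (t := t - 2) (i := i) (ω := ω)])

theorem sqrt_cumSq_le_invStep : √(1 + cumSq g (t - 2) i ω) ≤ invStep g X t i ω :=
  Real.sqrt_le_sqrt (by linarith [pathSq_nonneg (X := X) (t := t - 2) (i := i) (ω := ω)])

theorem updateStep_pos : 0 < updateStep g X t i ω := one_div_pos.2 invStep_pos

theorem updateStep_le_one : updateStep g X t i ω ≤ 1 :=
  (div_le_one invStep_pos).2 one_le_invStep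

theorem updateStep_antitone : Antitone fun t => updateStep g X t i ω := fun _ _ h =>
  one_div_le_one_div_of_le invStep_pos (invStep_mono h)

theorem extrapStep_pos : 0 < extrapStep q g t i ω :=
  one_div_pos.2 (Real.rpow_pos_of_pos (by
    linarith [cumSq_nonneg (g := g) (t := t - 2) (i := i) (ω := ω)]) _)

theorem extrapStep_le_one (hq : q ≤ 1 / 4) : extrapStep q g t i ω ≤ 1 := by
  have h := cumSq_nonneg (g := g) (t := t - 2) (i := i) (ω := ω)
  have h1 : 1 ≤ (1 + cumSq g (t - 2) i ω) ^ (1 / 2 - q) :=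
    Real.one_le_rpow (by linarith) (by linarith)
  exact (div_le_one (zero_lt_one.trans_le h1)).2 h1

theorem extrapStep_antitone (hq : q ≤ 1 / 4) : Antitone fun t => extrapStep q g t i ω := by
  intro s t hst
  have h0 := cumSq_nonneg (g := g) (t := s - 2) (i := i) (ω := ω)
  have h1 := cumSq_mono (g := g) (i := i) (ω := ω) (Nat.sub_le_sub_right hst 2)
  refine one_div_le_one_div_of_le (Real.rpow_pos_of_pos (by linarith) _) ?_
  exact Real.rpow_le_rpow (by linarith) (by simp only at h1; linarith) (by linarith)

/-- The base is at least `1` and `1/2 - q ≤ 1/2`; the extra path term only shrinks `η`. Thus `η + γ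
≤ 2γ` wherever noise enters through both steps. -/
theorem updateStep_le_extrapStep (hq0 : 0 ≤ q) : updateStep g X t i ω ≤ extrapStep q g t i ω := by
  have h0 := cumSq_nonneg (g := g) (t := t - 2) (i := i) (ω := ω)
  refine one_div_le_one_div_of_le (Real.rpow_pos_of_pos (by linarith) _) ?_
  refine le_trans ?_ (sqrt_cumSq_le_invStep (g := g) (X := X))
  rw [Real.sqrt_eq_rpow]
  exact Real.rpow_le_rpow_of_exponent_le (by linarith) (by linarith)

/-- Here `q ≤ 1/4` is decisive: `γ²` has exponent `1 - 2q ≥ 1/2`, so `γ²‖g‖²` sums to order `√λ`. -/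
theorem extrapStep_sq_le (hq : q ≤ 1 / 4) :
    extrapStep q g t i ω ^ 2 ≤ 1 / √(1 + cumSq g (t - 2) i ω) := by
  have h0 := cumSq_nonneg (g := g) (t := t - 2) (i := i) (ω := ω)
  rw [extrapStep, div_pow, one_pow]
  refine one_div_le_one_div_of_le (Real.sqrt_pos.2 (by linarith)) ?_
  rw [← Real.rpow_natCast, ← Real.rpow_mul (by linarith), Real.sqrt_eq_rpow]
  refine Real.rpow_le_rpow_of_exponent_le (by linarith) ?_
  push_cast
  linarith

theorem normalizedSq_nonneg : 0 ≤ normalizedSq g t i ω := by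
  unfold normalizedSq; positivity

theorem extrapStep_sq_mul_le (hq : q ≤ 1 / 4) {s : ℕ} (hst : t ≤ s) :
    extrapStep q g s i ω ^ 2 * ‖g t i ω‖ ^ 2 ≤ normalizedSq g t i ω := by
  have h1 : extrapStep q g s i ω ≤ extrapStep q g t i ω := extrapStep_antitone hq hst
  have h2 : extrapStep q g s i ω ^ 2 ≤ extrapStep q g t i ω ^ 2 :=
    pow_le_pow_left₀ extrapStep_pos.le h1 2
  have h3 := h2.trans (extrapStep_sq_le (g := g) (t := t) (i := i) (ω := ω) hq)
  rw [normalizedSq, div_eq_mul_one_div, mul_comm]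
  exact mul_le_mul_of_nonneg_left h3 (by positivity)

theorem sq_div_invStep_le : ‖g t i ω‖ ^ 2 / invStep g X t i ω ≤ normalizedSq g t i ω :=
  div_le_div_of_nonneg_left (by positivity)
    (Real.sqrt_pos.2 (by linarith [cumSq_nonneg (g := g) (t := t - 2) (i := i) (ω := ω)]))
    sqrt_cumSq_le_invStep

end StepSizes

/-! ### Pathwise estimates -/

section Pathwise

variable {N : ℕ} {d : Fin N → ℕ} {Ω : Type*} {ℓ : Fin N → JointAction d → ℝ} {L : ℝ≥0}
  {G B q R : ℝ} {ξ : ℕ → (i : Fin N) → Ω → Action d i} {X x : ℕ → Ω → JointAction d}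

/-- The weighted squared distance of player `i` to `p`. -/
noncomputable def weightedDist (g : ℕ → (i : Fin N) → Ω → Action d i)
    (X : ℕ → Ω → JointAction d) (p : JointAction d) (t : ℕ) (i : Fin N) (ω : Ω) : ℝ :=
  invStep g X t i ω * ‖X t ω i - p i‖ ^ 2

/-- The joint action at round `t + 1` with the noise of round `t` removed. -/
noncomputable def denoised (ℓ : Fin N → JointAction d → ℝ) (q : ℝ)
    (ξ : ℕ → (i : Fin N) → Ω → Action d i) (X x : ℕ → Ω → JointAction d) (t : ℕ) (ω : Ω) :
    JointAction d :=
  WithLp.toLp 2 fun i => X 1 ω i -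
    updateStep (feedback ℓ x ξ) X (t + 1) i ω •
      ∑ s ∈ Finset.Icc 1 (t - 1), feedback ℓ x ξ s i ω -
    (updateStep (feedback ℓ x ξ) X (t + 1) i ω + extrapStep q (feedback ℓ x ξ) (t + 1) i ω) •
      indivGrad ℓ i (x t ω)

local notation "fb" => feedback ℓ x ξ
local notation "stepγ" => extrapStep q (feedback ℓ x ξ)
local notation "stepη" => updateStep (feedback ℓ x ξ) X
local notation "stepρ" => invStep (feedback ℓ x ξ) X
local notation "nsq" => normalizedSq (feedback ℓ x ξ)

theorem feedback_zero (i : Fin N) (ω : Ω) : fb 0 i ω = 0 := rfl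

theorem feedback_of_pos {t : ℕ} (ht : 1 ≤ t) (i : Fin N) (ω : Ω) :
    fb t i ω = indivGrad ℓ i (x t ω) + ξ t i ω := by
  rw [feedback, if_neg (by omega)]

theorem normalizedSq_zero (i : Fin N) (ω : Ω) : nsq 0 i ω = 0 := by
  simp [normalizedSq, feedback_zero]

theorem RunsAdaptiveOptDAPlus.eq_sub (hrun : RunsAdaptiveOptDAPlus ℓ q ξ X x) {t : ℕ}
    (ht : 1 ≤ t) (i : Fin N) (ω : Ω) :
    X t ω i = X 1 ω i - stepη t i ω • ∑ s ∈ Finset.Icc 1 (t - 1), fb s i ω := by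
  obtain ⟨t, rfl⟩ : ∃ s, t = s + 1 := ⟨t - 1, by omega⟩
  rcases Nat.eq_zero_or_pos t with rfl | h
  · simp
  · simpa using hrun.update t h i ω

theorem weightedDist_nonneg {p : JointAction d} {t : ℕ} {i : Fin N} {ω : Ω} :
    0 ≤ weightedDist (feedback ℓ x ξ) X p t i ω :=
  mul_nonneg invStep_pos.le (by positivity)

/-- Dual averaging evaluates `g_t` at `X_{t+1} - p`. Writing this as `(x_t - p) + γ_t g_{t-1} - (X_t
- X_{t+1})` exposes the regret at the played action and the correlation of consecutive feedbacks. -/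
theorem RunsAdaptiveOptDAPlus.descent (hrun : RunsAdaptiveOptDAPlus ℓ q ξ X x) {t : ℕ}
    (ht : 1 ≤ t) (p : JointAction d) (i : Fin N) (ω : Ω) :
    weightedDist (feedback ℓ x ξ) X p (t + 1) i ω ≤ weightedDist (feedback ℓ x ξ) X p t i ω +
      (stepρ (t + 1) i ω - stepρ t i ω) * ‖X 1 ω i - p i‖ ^ 2 -
      2 * inner ℝ (fb t i ω) (x t ω i - p i) -
      2 * stepγ t i ω * inner ℝ (fb t i ω) (fb (t - 1) i ω) +
      2 * inner ℝ (fb t i ω) (X t ω i - X (t + 1) ω i) -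
      stepρ t i ω * ‖X t ω i - X (t + 1) ω i‖ ^ 2 := by
  have hX := hrun.eq_sub ht i ω
  have hX' := hrun.eq_sub (Nat.le_succ_of_le ht) i ω
  obtain ⟨s, rfl⟩ : ∃ s, t = s + 1 := ⟨t - 1, by omega⟩
  rw [Nat.succ_eq_add_one, Nat.add_sub_cancel, Finset.sum_Icc_succ_top (by omega)] at hX'
  have h := dualAveraging_descent (x₁ := X 1 ω i) (p := p i)
    (S := ∑ s ∈ Finset.Icc 1 (s + 1 - 1), fb s i ω) (g := fb (s + 1) i ω)
    (updateStep_pos (g := fb) (X := X) (t := s + 1 + 1) (i := i) (ω := ω))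
    (updateStep_antitone (g := fb) (X := X) (i := i) (ω := ω) (Nat.le_succ (s + 1)))
  simp only [Nat.add_sub_cancel] at h hX
  rw [← hX, ← hX'] at h
  simp only [updateStep_eq, div_div_eq_mul_div, div_one] at h
  have hx := hrun.extrapolate (s + 1) (by omega) i ω
  have e : X (s + 1 + 1) ω i - p i = (x (s + 1) ω i - p i) +
      stepγ (s + 1) i ω • fb (s + 1 - 1) i ω - (X (s + 1) ω i - X (s + 1 + 1) ω i) := by
    rw [hx]; abel
  have e2 : inner ℝ (fb (s + 1) i ω) (X (s + 1 + 1) ω i - p i) =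
      inner ℝ (fb (s + 1) i ω) (x (s + 1) ω i - p i) +
      stepγ (s + 1) i ω * inner ℝ (fb (s + 1) i ω) (fb (s + 1 - 1) i ω) -
      inner ℝ (fb (s + 1) i ω) (X (s + 1) ω i - X (s + 1 + 1) ω i) := by
    rw [e, inner_sub_right, inner_add_right, inner_smul_right]
  rw [e2] at h
  simp only [weightedDist]
  linarith

/-- The feedback `g_t` enters the next action twice, through the update with weight `η_{t+1}` and
through the extrapolation with weight `γ_{t+1}`. Both weights ignore `g_t` because of the delay, so
the dependence on `ξ_t` is linear with coefficients known at time `t`. -/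
theorem RunsAdaptiveOptDAPlus.eq_denoised (hrun : RunsAdaptiveOptDAPlus ℓ q ξ X x) {t : ℕ}
    (ht : 1 ≤ t) (i : Fin N) (ω : Ω) :
    x (t + 1) ω i = denoised ℓ q ξ X x t ω i -
      (stepη (t + 1) i ω + stepγ (t + 1) i ω) • ξ t i ω := by
  have hx := hrun.extrapolate (t + 1) (by omega) i ω
  have hX := hrun.update t ht i ω
  obtain ⟨s, rfl⟩ : ∃ s, t = s + 1 := ⟨t - 1, by omega⟩
  rw [Finset.sum_Icc_succ_top (by omega)] at hX
  rw [hx, hX, denoised]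
  simp only [Nat.add_sub_cancel, feedback_of_pos (Nat.le_add_left 1 s)]
  module

theorem norm_sub_denoised_sq_le (hrun : RunsAdaptiveOptDAPlus ℓ q ξ X x) (hq0 : 0 ≤ q) {t : ℕ}
    (ht : 1 ≤ t) (ω : Ω) :
    ‖x (t + 1) ω - denoised ℓ q ξ X x t ω‖ ^ 2 ≤
      4 * ∑ j, stepγ (t + 1) j ω ^ 2 * ‖ξ t j ω‖ ^ 2 := by
  rw [PiLp.norm_sq_eq_of_L2, Finset.mul_sum]
  refine Finset.sum_le_sum fun j _ => ?_
  rw [PiLp.sub_apply, hrun.eq_denoised ht, sub_sub_cancel_left, norm_neg, norm_smul, mul_pow,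
    ← mul_assoc]
  refine mul_le_mul_of_nonneg_right ?_ (by positivity)
  have h1 := updateStep_pos (g := fb) (X := X) (t := t + 1) (i := j) (ω := ω)
  have h2 := updateStep_le_extrapStep (g := fb) (X := X) (t := t + 1) (i := j) (ω := ω) hq0
  rw [Real.norm_eq_abs, sq_abs]
  nlinarith

theorem norm_play_sub_sq_le (hrun : RunsAdaptiveOptDAPlus ℓ q ξ X x) (hq1 : q ≤ 1 / 4) {t : ℕ}
    (ht : 1 ≤ t) (ω : Ω) :
    ‖x (t + 1) ω - x t ω‖ ^ 2 ≤
      ∑ j, (3 * ‖X t ω j - X (t + 1) ω j‖ ^ 2 + 3 * (nsq t j ω + nsq (t - 1) j ω)) := by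
  rw [PiLp.norm_sq_eq_of_L2]
  refine Finset.sum_le_sum fun j _ => ?_
  rw [PiLp.sub_apply]
  have e : x (t + 1) ω j - x t ω j = -(X t ω j - X (t + 1) ω j) +
      -(stepγ (t + 1) j ω • fb t j ω) + stepγ t j ω • fb (t - 1) j ω := by
    rw [hrun.extrapolate (t + 1) (by omega), hrun.extrapolate t ht, Nat.add_sub_cancel]
    abel
  rw [e]
  refine (norm_add_add_sq_le _ _ _).trans ?_
  have h1 := extrapStep_sq_mul_le (g := fb) (i := j) (ω := ω) hq1 (Nat.le_succ t)
  have h2 := extrapStep_sq_mul_le (g := fb) (i := j) (ω := ω) hq1 (Nat.sub_le t 1)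
  simp only [norm_neg, norm_smul, mul_pow, Real.norm_eq_abs, sq_abs]
  rw [Nat.succ_eq_add_one] at h1
  linarith

/-- Lipschitz continuity gives the variation in terms of the path and of normalized feedback.
Truncation of the path term at `4G²`, available because gradients are bounded, is what later allows
the delayed drift to absorb it (`sum_min_sub_le`). -/
theorem norm_grad_sub_sq_le (hsm : ConvexSmooth ℓ L) (hG : ∀ i y, ‖indivGrad ℓ i y‖ ≤ G)
    (hrun : RunsAdaptiveOptDAPlus ℓ q ξ X x) (hq1 : q ≤ 1 / 4) {t : ℕ} (ht : 1 ≤ t) (i : Fin N)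
    (ω : Ω) :
    ‖indivGrad ℓ i (x (t + 1) ω) - indivGrad ℓ i (x t ω)‖ ^ 2 ≤
      ∑ j, (min (4 * G ^ 2) (3 * L ^ 2 * ‖X t ω j - X (t + 1) ω j‖ ^ 2) +
        3 * L ^ 2 * (nsq t j ω + nsq (t - 1) j ω)) := by
  have h1 : ‖indivGrad ℓ i (x (t + 1) ω) - indivGrad ℓ i (x t ω)‖ ^ 2 ≤ 4 * G ^ 2 := by
    have h := norm_sub_le (indivGrad ℓ i (x (t + 1) ω)) (indivGrad ℓ i (x t ω))
    have h' : ‖indivGrad ℓ i (x (t + 1) ω) - indivGrad ℓ i (x t ω)‖ ≤ 2 * G := by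
      linarith [hG i (x (t + 1) ω), hG i (x t ω)]
    nlinarith [norm_nonneg (indivGrad ℓ i (x (t + 1) ω) - indivGrad ℓ i (x t ω))]
  have h2 : ‖indivGrad ℓ i (x (t + 1) ω) - indivGrad ℓ i (x t ω)‖ ^ 2 ≤
      (∑ j, 3 * L ^ 2 * ‖X t ω j - X (t + 1) ω j‖ ^ 2) +
        ∑ j, 3 * L ^ 2 * (nsq t j ω + nsq (t - 1) j ω) := by
    have h := (hsm.lipschitz i).norm_sub_le (x (t + 1) ω) (x t ω)
    have h' := pow_le_pow_left₀ (norm_nonneg _) h 2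
    rw [mul_pow] at h'
    refine h'.trans ((mul_le_mul_of_nonneg_left (norm_play_sub_sq_le hrun hq1 ht ω)
      (by positivity)).trans_eq ?_)
    rw [Finset.mul_sum, ← Finset.sum_add_distrib]
    exact Finset.sum_congr rfl fun j _ => by ring
  have h3 : 0 ≤ ∑ j, 3 * (L : ℝ) ^ 2 * (nsq t j ω + nsq (t - 1) j ω) :=
    Finset.sum_nonneg fun j _ => mul_nonneg (by positivity)
      (add_nonneg normalizedSq_nonneg normalizedSq_nonneg)
  have h4 := min_sum_le Finset.univ (A := 4 * G ^ 2) (by positivity)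
    (b := fun j => 3 * (L : ℝ) ^ 2 * ‖X t ω j - X (t + 1) ω j‖ ^ 2) (fun j => by positivity)
  rw [Finset.sum_add_distrib]
  refine le_trans ?_ (add_le_add_left h4 _)
  rw [← min_add_add_right]
  exact le_min (by linarith) h2

/-- The correlation of consecutive feedbacks produces a negative drift, up to summable errors
and terms that are centered conditionally on the first `t` actions. -/
theorem cross_term_le (hsm : ConvexSmooth ℓ L) (hG : ∀ i y, ‖indivGrad ℓ i y‖ ≤ G)
    (hrun : RunsAdaptiveOptDAPlus ℓ q ξ X x) (hq0 : 0 ≤ q) (hq1 : q ≤ 1 / 4) {t : ℕ} (ht : 1 ≤ t)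
    (ω : Ω) :
    ∑ i, -2 * stepγ (t + 1) i ω * inner ℝ (indivGrad ℓ i (x (t + 1) ω)) (fb t i ω) ≤
      ∑ i, (-(stepγ (t + 1) i ω * ‖indivGrad ℓ i (x (t + 1) ω)‖ ^ 2) +
        N * min (4 * G ^ 2) (3 * L ^ 2 * ‖X t ω i - X (t + 1) ω i‖ ^ 2) +
        (3 * L ^ 2 * N + L * (4 * N + 1)) * (nsq t i ω + nsq (t - 1) i ω) +
        inner ℝ (ξ t i ω) ((-2 * stepγ (t + 1) i ω) • indivGrad ℓ i (denoised ℓ q ξ X x t ω) +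
          (-2 * (L * (4 * N + 1)) * stepγ (t + 1) i ω ^ 2) • indivGrad ℓ i (x t ω))) := by
  set V' := fun i => indivGrad ℓ i (x (t + 1) ω) with hV'
  set V := fun i => indivGrad ℓ i (x t ω) with hV
  set W := fun i => indivGrad ℓ i (denoised ℓ q ξ X x t ω) with hW
  set c : Fin N → ℝ := fun i => stepγ (t + 1) i ω with hc
  have hc0 : ∀ i, 0 ≤ c i := fun i => extrapStep_pos.le
  have hc1 : ∀ i, c i ≤ 1 := fun i => extrapStep_le_one hq1
  -- `Q` controls the gradient variation and `P` the noise that the Lipschitz comparison with the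
  -- denoised action leaves behind.
  set Q := ∑ j, (min (4 * G ^ 2) (3 * L ^ 2 * ‖X t ω j - X (t + 1) ω j‖ ^ 2) +
        3 * L ^ 2 * (nsq t j ω + nsq (t - 1) j ω)) with hQ
  set P := ∑ j, c j ^ 2 * ‖ξ t j ω‖ ^ 2 with hP
  have hind : ∀ i, -2 * c i * inner ℝ (V' i) (fb t i ω) ≤
      -(c i * ‖V' i‖ ^ 2) + Q + L * (4 * P + c i ^ 2 * ‖ξ t i ω‖ ^ 2) +
        inner ℝ (ξ t i ω) ((-2 * c i) • W i) := by
    intro i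
    have h1 : ‖V' i - V i‖ ^ 2 ≤ Q := norm_grad_sub_sq_le hsm hG hrun hq1 ht i ω
    have h2 : ‖V' i - W i‖ ≤ L * ‖x (t + 1) ω - denoised ℓ q ξ X x t ω‖ :=
      (hsm.lipschitz i).norm_sub_le _ _
    have h3 : ‖x (t + 1) ω - denoised ℓ q ξ X x t ω‖ ^ 2 ≤ 4 * P :=
      norm_sub_denoised_sq_le hrun hq0 ht ω
    have h4 : fb t i ω = V i + ξ t i ω := feedback_of_pos ht i ω
    have h5 : ‖V' i - V i‖ ^ 2 = ‖V' i‖ ^ 2 - 2 * inner ℝ (V' i) (V i) + ‖V i‖ ^ 2 :=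
      norm_sub_sq_real _ _
    have h6 : c i * ‖V' i - V i‖ ^ 2 ≤ Q := by
      nlinarith [hc0 i, hc1 i, sq_nonneg ‖V' i - V i‖]
    -- Only the difference `V' - W` is estimated in norm: it is at most `L` times the distance to
    -- the denoised action, and Young's inequality makes the product quadratic in `γξ`.
    have h7 : -2 * c i * inner ℝ (V' i - W i) (ξ t i ω) ≤
        L * (4 * P + c i ^ 2 * ‖ξ t i ω‖ ^ 2) := by
      have a1 := neg_abs_le (inner ℝ (V' i - W i) (ξ t i ω))
      have a2 := abs_real_inner_le_norm (V' i - W i) (ξ t i ω)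
      have a3 : ‖V' i - W i‖ * ‖ξ t i ω‖ ≤
          L * ‖x (t + 1) ω - denoised ℓ q ξ X x t ω‖ * ‖ξ t i ω‖ :=
        mul_le_mul_of_nonneg_right h2 (norm_nonneg _)
      have a4 : -2 * c i * inner ℝ (V' i - W i) (ξ t i ω) ≤
          2 * c i * (L * ‖x (t + 1) ω - denoised ℓ q ξ X x t ω‖ * ‖ξ t i ω‖) := by
        nlinarith [hc0 i]
      have a5 : 2 * ‖x (t + 1) ω - denoised ℓ q ξ X x t ω‖ * (c i * ‖ξ t i ω‖) ≤
          4 * P + c i ^ 2 * ‖ξ t i ω‖ ^ 2 := by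
        nlinarith [sq_nonneg (‖x (t + 1) ω - denoised ℓ q ξ X x t ω‖ - c i * ‖ξ t i ω‖)]
      have a6 := mul_le_mul_of_nonneg_left a5 L.coe_nonneg
      linarith
    have h8 : inner ℝ (V' i - W i) (ξ t i ω) =
        inner ℝ (V' i) (ξ t i ω) - inner ℝ (W i) (ξ t i ω) := inner_sub_left _ _ _
    rw [h4, inner_add_right, inner_smul_right, real_inner_comm (W i)]
    rw [h8] at h7
    rw [h5] at h6
    have h9 : 0 ≤ c i * ‖V i‖ ^ 2 := mul_nonneg (hc0 i) (by positivity)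
    linarith
  -- Expanding `‖g‖² = ‖V + ξ‖²` trades the noise for the feedback and one more centered term; `nsq
  -- (t - 1)` is added only to match the other error.
  have hPle : P ≤ ∑ i, ((nsq t i ω + nsq (t - 1) i ω) +
      inner ℝ (ξ t i ω) ((-2 * c i ^ 2) • V i)) := by
    refine Finset.sum_le_sum fun i _ => ?_
    have h1 : c i ^ 2 * ‖fb t i ω‖ ^ 2 ≤ nsq t i ω := extrapStep_sq_mul_le hq1 (Nat.le_succ t)
    have h0 : 0 ≤ nsq (t - 1) i ω := normalizedSq_nonneg
    rw [feedback_of_pos ht, norm_add_sq_real] at h1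
    rw [inner_smul_right, real_inner_comm]
    have : 0 ≤ c i ^ 2 * ‖V i‖ ^ 2 := by positivity
    simp only [hV] at this ⊢
    linarith
  refine le_trans (Finset.sum_le_sum fun i _ => hind i) ?_
  have hLN : (0 : ℝ) ≤ L * (4 * N + 1) := by positivity
  have hfin : L * (4 * N + 1) * P ≤ ∑ i, L * (4 * N + 1) * ((nsq t i ω + nsq (t - 1) i ω) +
      inner ℝ (ξ t i ω) ((-2 * c i ^ 2) • V i)) :=
    (mul_le_mul_of_nonneg_left hPle hLN).trans_eq (Finset.mul_sum ..)
  have eQ : ∑ _i : Fin N, Q = ∑ i : Fin N,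
      (N * min (4 * G ^ 2) (3 * L ^ 2 * ‖X t ω i - X (t + 1) ω i‖ ^ 2) +
        3 * L ^ 2 * N * (nsq t i ω + nsq (t - 1) i ω)) := by
    rw [Finset.sum_const, Finset.card_univ, Fintype.card_fin, nsmul_eq_mul, hQ, Finset.mul_sum]
    exact Finset.sum_congr rfl fun i _ => by ring
  -- Each of the `N` players pays `4P`, and the individual terms add up to one further `P`: hence
  -- `4N + 1`.
  have eP : ∑ i, L * (4 * P + c i ^ 2 * ‖ξ t i ω‖ ^ 2) = L * (4 * N + 1) * P := by
    rw [← Finset.mul_sum, Finset.sum_add_distrib, ← hP, Finset.sum_const, Finset.card_univ,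
      Fintype.card_fin, nsmul_eq_mul]
    ring
  rw [Finset.sum_add_distrib, Finset.sum_add_distrib, Finset.sum_add_distrib, eQ, eP]
  have step := add_le_add_right hfin (∑ i, -(c i * ‖V' i‖ ^ 2) + ∑ i : Fin N,
      (N * min (4 * G ^ 2) (3 * L ^ 2 * ‖X t ω i - X (t + 1) ω i‖ ^ 2) +
        3 * L ^ 2 * N * (nsq t i ω + nsq (t - 1) i ω)) +
      ∑ i, inner ℝ (ξ t i ω) ((-2 * c i) • W i))
  refine le_trans (le_of_eq (by ring)) (step.trans_eq ?_)
  simp only [← Finset.sum_add_distrib]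
  refine Finset.sum_congr rfl fun i _ => ?_
  simp only [inner_add_right, inner_smul_right]
  ring

end Pathwise

/-! ### Measurability of the iterates -/

section Joint

variable {N : ℕ} {d : Fin N → ℕ} {Ω : Type*} {m m0 : MeasurableSpace Ω} {μ : Measure Ω}

theorem BddMeas.apply {y : Ω → JointAction d} (hy : BddMeas m μ y) (i : Fin N) :
    BddMeas m μ (fun ω => y ω i) :=
  hy.comp_continuous (φ := fun z : JointAction d => z i) (by fun_prop)

theorem BddMeas.of_apply {y : Ω → JointAction d} (hy : ∀ i, BddMeas m μ (fun ω => y ω i)) :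
    BddMeas m μ y := by
  refine ⟨?_, ?_⟩
  · have h : @Measurable _ _ m _ (fun ω => WithLp.ofLp (y ω)) :=
      (@measurable_pi_iff _ _ _ m _ _).2 fun i => (hy i).meas.measurable
    exact ((WithLp.measurable_toLp 2 _).comp h).stronglyMeasurable
  · obtain ⟨C, hC⟩ := (BddMeas.sum Finset.univ fun i _ => (hy i).norm_sq).bdd
    refine ⟨C + 1, ?_⟩
    filter_upwards [hC] with ω h
    rw [← PiLp.norm_sq_eq_of_L2, Real.norm_of_nonneg (by positivity)] at h
    nlinarith [sq_nonneg (‖y ω‖ - 1 / 2)]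

end Joint

/-- The standing assumptions on the game, the noise and the learning algorithm. -/
structure NoisyRun {N : ℕ} {d : Fin N → ℕ} {Ω : Type*} [MeasurableSpace Ω] (μ : Measure Ω)
    (ℓ : Fin N → JointAction d → ℝ) (L : ℝ≥0) (σM G B q R : ℝ)
    (ξ : ℕ → (i : Fin N) → Ω → Action d i) (X x : ℕ → Ω → JointAction d) : Prop where
  q_pos : 0 < q
  q_le : q ≤ 1 / 4
  smooth : ConvexSmooth ℓ L
  stable : VariationallyStable ℓ
  noise : NoiseModel μ ℓ x ξ 0 σM
  bounded : BoundedFeedback μ ℓ ξ G B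
  measurable_init : Measurable (X 1)
  init_le : ∀ᵐ ω ∂μ, ‖X 1 ω‖ ≤ R
  run : RunsAdaptiveOptDAPlus ℓ q ξ X x

section Measurability

variable {N : ℕ} {d : Fin N → ℕ} {Ω : Type*} {m0 : MeasurableSpace Ω} {μ : Measure Ω}
  {ℓ : Fin N → JointAction d → ℝ} {L : ℝ≥0} {σM G B q R : ℝ}
  {ξ : ℕ → (i : Fin N) → Ω → Action d i} {X x : ℕ → Ω → JointAction d}

local notation "fb" => feedback ℓ x ξ
local notation "stepγ" => extrapStep q (feedback ℓ x ξ)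
local notation "stepη" => updateStep (feedback ℓ x ξ) X
local notation "stepρ" => invStep (feedback ℓ x ξ) X
local notation "nsq" => normalizedSq (feedback ℓ x ξ)

/-- The initial point and the feedback before round `t` are `m`-measurable and bounded. -/
structure KnowsUntil (μ : Measure Ω) (g : ℕ → (i : Fin N) → Ω → Action d i)
    (X : ℕ → Ω → JointAction d) (m : MeasurableSpace Ω) (t : ℕ) : Prop where
  start : ∀ i, BddMeas m μ (fun ω => X 1 ω i)
  feedback : ∀ s < t, ∀ i, BddMeas m μ (g s i)

namespace KnowsUntil

variable {m : MeasurableSpace Ω} {t : ℕ}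

theorem cumSq (h : KnowsUntil μ fb X m t) {s : ℕ} (hs : s < t) (i : Fin N) :
    BddMeas m μ (cumSq fb s i) :=
  BddMeas.sum _ fun k hk => (h.feedback k ((Finset.mem_Icc.1 hk).2.trans_lt hs) i).norm_sq

theorem extrapStep (h : KnowsUntil μ fb X m t) (hq1 : q ≤ 1 / 4) (ht : 1 ≤ t) {s : ℕ}
    (hs : s ≤ t + 1) (i : Fin N) : BddMeas m μ (stepγ s i) := by
  refine ⟨?_, 1, ae_of_all _ fun ω => ?_⟩
  · have h1 : @Measurable _ _ m _ (NoisyGame.cumSq fb (s - 2) i) :=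
      (h.cumSq (by omega) i).meas.measurable
    exact (((h1.const_add 1).pow_const (1 / 2 - q)).const_div 1).stronglyMeasurable
  · rw [Real.norm_of_nonneg extrapStep_pos.le]
    exact extrapStep_le_one hq1

theorem iterate_of_invStep (h : KnowsUntil μ fb X m t) (hrun : RunsAdaptiveOptDAPlus ℓ q ξ X x)
    {s : ℕ} (hs1 : 1 ≤ s) (hs : s ≤ t) (i : Fin N) (hη : BddMeas m μ (stepη s i)) :
    BddMeas m μ (fun ω => X s ω i) := by
  simp only [hrun.eq_sub hs1]
  exact (h.start i).sub (hη.smul (BddMeas.sum _ fun k hk => h.feedback k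
    (by have := (Finset.mem_Icc.1 hk).2; omega) i))

theorem invStep_of_iterate (h : KnowsUntil μ fb X m t) (ht : 1 ≤ t) {s : ℕ} (hs : s ≤ t + 1)
    (i : Fin N) (hX : ∀ k, 1 ≤ k → k < s → BddMeas m μ (fun ω => X k ω i)) :
    BddMeas m μ (stepρ s i) := by
  refine (((BddMeas.const 1).add (h.cumSq (by omega) i)).add
    (BddMeas.sum _ fun k hk => ?_)).sqrt
  have := Finset.mem_Icc.1 hk
  exact ((hX k (by omega) (by omega)).sub (hX (k + 1) (by omega) (by omega))).norm_sq

theorem updateStep_of_invStep {s : ℕ} {i : Fin N} (h : BddMeas m μ (stepρ s i)) :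
    BddMeas m μ (stepη s i) := by
  refine ⟨?_, 1, ae_of_all _ fun ω => ?_⟩
  · have h1 : @Measurable _ _ m _ (stepρ s i) := h.meas.measurable
    exact (h1.const_div 1).stronglyMeasurable
  · rw [Real.norm_of_nonneg updateStep_pos.le]
    exact updateStep_le_one

/-- `X_s` needs `η_s`, which in turn needs only earlier iterates; strong induction unties this
circle. -/
theorem iterate (h : KnowsUntil μ fb X m t) (hrun : RunsAdaptiveOptDAPlus ℓ q ξ X x)
    {s : ℕ} (hs1 : 1 ≤ s) (hs : s ≤ t) (i : Fin N) : BddMeas m μ (fun ω => X s ω i) := by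
  induction s using Nat.strong_induction_on with
  | _ s ih =>
    refine h.iterate_of_invStep hrun hs1 hs i (updateStep_of_invStep ?_)
    exact h.invStep_of_iterate (hs1.trans hs) (by omega) i fun k hk hks =>
      ih k hks hk (by omega)

theorem invStep (h : KnowsUntil μ fb X m t) (hrun : RunsAdaptiveOptDAPlus ℓ q ξ X x)
    (ht : 1 ≤ t) {s : ℕ} (hs : s ≤ t + 1) (i : Fin N) : BddMeas m μ (stepρ s i) :=
  h.invStep_of_iterate ht hs i fun _ hk hks => h.iterate hrun hk (by omega) i

theorem updateStep (h : KnowsUntil μ fb X m t) (hrun : RunsAdaptiveOptDAPlus ℓ q ξ X x)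
    (ht : 1 ≤ t) {s : ℕ} (hs : s ≤ t + 1) (i : Fin N) : BddMeas m μ (stepη s i) :=
  updateStep_of_invStep (h.invStep hrun ht hs i)

theorem play (h : KnowsUntil μ fb X m t) (hrun : RunsAdaptiveOptDAPlus ℓ q ξ X x)
    (hq1 : q ≤ 1 / 4) {s : ℕ} (hs1 : 1 ≤ s) (hs : s ≤ t) : BddMeas m μ (x s) := by
  refine BddMeas.of_apply fun i => ?_
  simp only [hrun.extrapolate s hs1]
  exact (h.iterate hrun hs1 hs i).sub ((h.extrapStep hq1 (hs1.trans hs) (by omega) i).smul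
    (h.feedback _ (by omega) i))

theorem grad (h : KnowsUntil μ fb X m t) (hrun : RunsAdaptiveOptDAPlus ℓ q ξ X x)
    (hq1 : q ≤ 1 / 4) (hsm : ConvexSmooth ℓ L) {s : ℕ} (hs1 : 1 ≤ s) (hs : s ≤ t) (i : Fin N) :
    BddMeas m μ (fun ω => indivGrad ℓ i (x s ω)) :=
  (h.play hrun hq1 hs1 hs).comp_continuous (hsm.lipschitz i).continuous

theorem denoised (h : KnowsUntil μ fb X m t) (hrun : RunsAdaptiveOptDAPlus ℓ q ξ X x)
    (hq1 : q ≤ 1 / 4) (hsm : ConvexSmooth ℓ L) (ht : 1 ≤ t) :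
    BddMeas m μ (denoised ℓ q ξ X x t) := by
  refine BddMeas.of_apply fun i => ?_
  have hη := h.updateStep hrun ht le_rfl i
  exact ((h.start i).sub (hη.smul (BddMeas.sum _ fun k hk => h.feedback k
    (by have := (Finset.mem_Icc.1 hk).2; omega) i))).sub
    ((hη.add (h.extrapStep hq1 ht le_rfl i)).smul (h.grad hrun hq1 hsm ht le_rfl i))

theorem normalizedSq (h : KnowsUntil μ fb X m t) {s : ℕ} (hs : s < t) (i : Fin N) :
    BddMeas m μ (nsq s i) := by
  obtain ⟨C, hC⟩ := (h.feedback s hs i).norm_sq.bdd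
  refine ⟨?_, C, ?_⟩
  · have h1 : @Measurable _ _ m _ (NoisyGame.cumSq fb (s - 2) i) :=
      (h.cumSq (by omega) i).meas.measurable
    have h2 : @Measurable _ _ m _ (fun ω => ‖fb s i ω‖ ^ 2) :=
      (h.feedback s hs i).norm_sq.meas.measurable
    exact (h2.div (h1.const_add 1).sqrt).stronglyMeasurable
  · filter_upwards [hC] with ω hω
    refine le_trans ?_ hω
    rw [Real.norm_of_nonneg normalizedSq_nonneg, Real.norm_of_nonneg (by positivity)]
    refine div_le_self (by positivity) (Real.one_le_sqrt.2 ?_)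
    linarith [cumSq_nonneg (g := fb) (t := s - 2) (i := i) (ω := ω)]

theorem pathSq (h : KnowsUntil μ fb X m t) (hrun : RunsAdaptiveOptDAPlus ℓ q ξ X x)
    {s : ℕ} (hs : s < t) (i : Fin N) : BddMeas m μ (pathSq X s i) := by
  refine BddMeas.sum _ fun k hk => ?_
  have := Finset.mem_Icc.1 hk
  exact ((h.iterate hrun (by omega) (by omega) i).sub
    (h.iterate hrun (by omega) (by omega) i)).norm_sq

theorem weightedDist (h : KnowsUntil μ fb X m t) (hrun : RunsAdaptiveOptDAPlus ℓ q ξ X x)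
    (p : JointAction d) {s : ℕ} (hs1 : 1 ≤ s) (hs : s ≤ t) (i : Fin N) :
    BddMeas m μ (weightedDist fb X p s i) :=
  (h.invStep hrun (hs1.trans hs) (by omega) i).mul
    ((h.iterate hrun hs1 hs i).sub (BddMeas.const _)).norm_sq

end KnowsUntil

theorem playHistory_mono (x : ℕ → Ω → JointAction d) :
    Monotone (playHistory x) := fun _ _ hst =>
  biSup_mono fun _ hs => ⟨hs.1, hs.2.trans hst⟩

theorem stronglyMeasurable_play {s t : ℕ} (hs1 : 1 ≤ s) (hst : s ≤ t) :
    StronglyMeasurable[playHistory x t] (x s) := by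
  have h1 : MeasurableSpace.comap (x s) (borel (JointAction d)) ≤ playHistory x t :=
    le_iSup₂_of_le s ⟨hs1, hst⟩ le_rfl
  rw [← BorelSpace.measurable_eq (α := JointAction d)] at h1
  have h2 : @Measurable _ _ (playHistory x t) _ (x s) := measurable_iff_comap_le.2 h1
  exact h2.stronglyMeasurable

/-! ### Past feedback is determined by the played actions -/

namespace NoisyRun

theorem noise_bddMeas (h : NoisyRun μ ℓ L σM G B q R ξ X x) {t : ℕ} (ht : 1 ≤ t) (i : Fin N) :
    BddMeas m0 μ (ξ t i) :=
  ⟨(h.noise.measurable t ht i).stronglyMeasurable, B, h.bounded.noise_le t ht i⟩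

theorem ae_feedback_le (h : NoisyRun μ ℓ L σM G B q R ξ X x) :
    ∀ᵐ ω ∂μ, ∀ t i, ‖fb t i ω‖ ≤ |G| + |B| := by
  refine ae_all_iff.2 fun t => ae_all_iff.2 fun i => ?_
  rcases Nat.eq_zero_or_pos t with rfl | ht
  · exact ae_of_all _ fun ω => by rw [feedback_zero, norm_zero]; positivity
  · filter_upwards [h.bounded.noise_le t ht i] with ω hω
    rw [feedback_of_pos ht]
    refine (norm_add_le _ _).trans (add_le_add ?_ (hω.trans (le_abs_self B)))
    exact (h.bounded.grad_le i _).trans (le_abs_self G)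

theorem feedback_bddMeas (h : NoisyRun μ ℓ L σM G B q R ξ X x) {m : MeasurableSpace Ω} {t : ℕ}
    {i : Fin N} (hm : StronglyMeasurable[m] (fb t i)) : BddMeas m μ (fb t i) :=
  ⟨hm, |G| + |B|, h.ae_feedback_le.mono fun _ hω => hω t i⟩

/-- Measurability of the actions is not assumed; it propagates from `X 1` and the noise. It must
precede `playHistory_le`. -/
theorem knowsUntil_ambient (h : NoisyRun μ ℓ L σM G B q R ξ X x) (t : ℕ) :
    KnowsUntil μ fb X m0 t := by
  induction t with
  | zero =>
    refine ⟨?_, fun s hs => absurd hs (Nat.not_lt_zero s)⟩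
    exact BddMeas.apply ⟨h.measurable_init.stronglyMeasurable, R, h.init_le⟩
  | succ t ih =>
    refine ⟨ih.start, fun s hs i => ?_⟩
    rcases Nat.lt_succ_iff_lt_or_eq.1 hs with hs | rfl
    · exact ih.feedback s hs i
    · rcases Nat.eq_zero_or_pos s with rfl | hs1
      · exact BddMeas.const 0
      · have : fb s i = fun ω => indivGrad ℓ i (x s ω) + ξ s i ω :=
          funext fun ω => feedback_of_pos hs1 i ω
        rw [this]
        exact (ih.grad h.run h.q_le h.smooth hs1 le_rfl i).add (h.noise_bddMeas hs1 i)

theorem playHistory_le (h : NoisyRun μ ℓ L σM G B q R ξ X x) (t : ℕ) : playHistory x t ≤ m0 := by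
  refine iSup₂_le fun s hs => ?_
  rw [← BorelSpace.measurable_eq (α := JointAction d)]
  exact ((h.knowsUntil_ambient s).play h.run h.q_le hs.1 le_rfl).meas.measurable.comap_le

/-- The history of actions alone reveals the feedback: `x 1 = X 1` because `g_0 = 0`, and `x (s +
1)` is affine in `g_s` with the positive coefficient `-(η_{s+1} + γ_{s+1})` up to sign. The delayed
step sizes are already known, so the relation can be solved for `g_s`. -/
theorem knowsUntil (h : NoisyRun μ ℓ L σM G B q R ξ X x) {t : ℕ} (ht : 1 ≤ t) :
    KnowsUntil μ fb X (playHistory x t) t := by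
  induction t, ht using Nat.le_induction with
  | base =>
    refine ⟨fun i => ?_, fun s hs i => ?_⟩
    · refine ⟨?_, ((h.knowsUntil_ambient 1).start i).bdd⟩
      have e : (fun ω => X 1 ω i) = fun ω => x 1 ω i := funext fun ω => by
        rw [h.run.extrapolate 1 le_rfl, Nat.sub_self, feedback_zero, smul_zero, sub_zero]
      rw [e]
      have hc : Continuous fun z : JointAction d => z i := by fun_prop
      exact hc.comp_stronglyMeasurable (stronglyMeasurable_play le_rfl le_rfl)
    · obtain rfl : s = 0 := by omega
      exact BddMeas.const 0
  | succ t ht ih =>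
    have hmono := playHistory_mono x (Nat.le_succ t)
    refine ⟨fun i => (ih.start i).mono hmono, fun s hs i => ?_⟩
    rcases Nat.lt_succ_iff_lt_or_eq.1 hs with hs | rfl
    · exact (ih.feedback s hs i).mono hmono
    · refine h.feedback_bddMeas ?_
      have hη := ((ih.updateStep h.run ht le_rfl i).mono hmono).meas
      have hγ := ((ih.extrapStep h.q_le ht le_rfl i).mono hmono).meas
      have hX := ((ih.start i).mono hmono).meas
      have hS := (((ih.updateStep h.run ht le_rfl i).smul (BddMeas.sum (Finset.Icc 1 (s - 1))
        fun k hk => ih.feedback k (by have := (Finset.mem_Icc.1 hk).2; omega) i)).mono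
          hmono).meas
      have hc : Continuous fun z : JointAction d => z i := by fun_prop
      have hx := hc.comp_stronglyMeasurable
        (stronglyMeasurable_play (x := x) (Nat.le_add_left 1 s) le_rfl)
      have e : fb s i = fun ω => (stepη (s + 1) i ω + stepγ (s + 1) i ω)⁻¹ •
          (X 1 ω i - stepη (s + 1) i ω • ∑ k ∈ Finset.Icc 1 (s - 1), fb k i ω - x (s + 1) ω i) := by
        funext ω
        have hpos : 0 < stepη (s + 1) i ω + stepγ (s + 1) i ω :=
          add_pos updateStep_pos extrapStep_pos
        rw [eq_inv_smul_iff₀ hpos.ne', h.run.eq_denoised ht, NoisyGame.denoised,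
          feedback_of_pos ht]
        simp only
        module
      rw [e]
      have hinv : StronglyMeasurable[playHistory x (s + 1)]
          fun ω => (stepη (s + 1) i ω + stepγ (s + 1) i ω)⁻¹ :=
        ((hη.add hγ).measurable.inv).stronglyMeasurable
      exact hinv.smul ((hX.sub hS).sub hx)

end NoisyRun

end Measurability

/-! ### The energy inequality -/

section Energy

variable {N : ℕ} {d : Fin N → ℕ} {Ω : Type*} {m0 : MeasurableSpace Ω} {μ : Measure Ω}
  {ℓ : Fin N → JointAction d → ℝ} {L : ℝ≥0} {σM G B q R : ℝ}
  {ξ : ℕ → (i : Fin N) → Ω → Action d i} {X x : ℕ → Ω → JointAction d}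

/-- The variation of the energy in round `t`, together with its negative drift and its direct
errors. -/
noncomputable def energyGain (ℓ : Fin N → JointAction d → ℝ) (q : ℝ)
    (ξ : ℕ → (i : Fin N) → Ω → Action d i) (X x : ℕ → Ω → JointAction d) (p : JointAction d)
    (t : ℕ) (ω : Ω) : ℝ :=
  ∑ i, (weightedDist (feedback ℓ x ξ) X p (t + 1) i ω - weightedDist (feedback ℓ x ξ) X p t i ω +
    extrapStep q (feedback ℓ x ξ) t i ω * ‖indivGrad ℓ i (x t ω)‖ ^ 2 +
    3 / 4 * (invStep (feedback ℓ x ξ) X t i ω * ‖X t ω i - X (t + 1) ω i‖ ^ 2) -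
    (invStep (feedback ℓ x ξ) X (t + 1) i ω - invStep (feedback ℓ x ξ) X t i ω) *
      ‖X 1 ω i - p i‖ ^ 2 -
    4 * normalizedSq (feedback ℓ x ξ) t i ω)

/-- The error caused in round `t + 1` by the feedback of round `t`. -/
noncomputable def crossError (ℓ : Fin N → JointAction d → ℝ) (L : ℝ≥0) (G : ℝ)
    (ξ : ℕ → (i : Fin N) → Ω → Action d i) (X x : ℕ → Ω → JointAction d) (t : ℕ) (ω : Ω) : ℝ :=
  ∑ i, (N * min (4 * G ^ 2) (3 * L ^ 2 * ‖X t ω i - X (t + 1) ω i‖ ^ 2) +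
    (3 * L ^ 2 * N + L * (4 * N + 1)) *
      (normalizedSq (feedback ℓ x ξ) t i ω + normalizedSq (feedback ℓ x ξ) (t - 1) i ω))

local notation "fb" => feedback ℓ x ξ
local notation "stepγ" => extrapStep q (feedback ℓ x ξ)
local notation "stepη" => updateStep (feedback ℓ x ξ) X
local notation "stepρ" => invStep (feedback ℓ x ξ) X
local notation "nsq" => normalizedSq (feedback ℓ x ξ)

theorem crossError_nonneg {t : ℕ} {ω : Ω} : 0 ≤ crossError ℓ L G ξ X x t ω := by
  refine Finset.sum_nonneg fun i _ => add_nonneg ?_ ?_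
  · exact mul_nonneg (by positivity) (le_min (by positivity) (by positivity))
  · exact mul_nonneg (by positivity) (add_nonneg normalizedSq_nonneg normalizedSq_nonneg)

theorem VariationallyStable.sum_inner_nonneg (hst : VariationallyStable ℓ) {p : JointAction d}
    (hp : IsNash ℓ p) (y : JointAction d) :
    0 ≤ ∑ i, inner ℝ (indivGrad ℓ i y) (y i - p i) := by
  have h := hst.inner_nonneg y p hp
  rwa [PiLp.inner_apply] at h

namespace NoisyRun

/-- Variational stability discards the regret of the true gradients. What multiplies `ξ_t` is known
before the noise is drawn. The term `γ‖V‖²` is kept on both sides, to be cancelled on the right by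
`cross_term_le`. -/
theorem energyGain_le (h : NoisyRun μ ℓ L σM G B q R ξ X x) {p : JointAction d}
    (hp : IsNash ℓ p) {t : ℕ} (ht : 1 ≤ t) (ω : Ω) :
    energyGain ℓ q ξ X x p t ω ≤ ∑ i, stepγ t i ω * ‖indivGrad ℓ i (x t ω)‖ ^ 2 +
      ∑ i, -2 * stepγ t i ω * inner ℝ (indivGrad ℓ i (x t ω)) (fb (t - 1) i ω) +
      ∑ i, inner ℝ (ξ t i ω) ((-2 : ℝ) • (x t ω i - p i) +
        (-2 * stepγ t i ω) • fb (t - 1) i ω) := by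
  have hVS := h.stable.sum_inner_nonneg hp (x t ω)
  have hind : ∀ i, weightedDist fb X p (t + 1) i ω - weightedDist fb X p t i ω +
      stepγ t i ω * ‖indivGrad ℓ i (x t ω)‖ ^ 2 +
      3 / 4 * (stepρ t i ω * ‖X t ω i - X (t + 1) ω i‖ ^ 2) -
      (stepρ (t + 1) i ω - stepρ t i ω) * ‖X 1 ω i - p i‖ ^ 2 - 4 * nsq t i ω ≤
      stepγ t i ω * ‖indivGrad ℓ i (x t ω)‖ ^ 2 +
      (-2 * stepγ t i ω * inner ℝ (indivGrad ℓ i (x t ω)) (fb (t - 1) i ω)) +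
      inner ℝ (ξ t i ω) ((-2 : ℝ) • (x t ω i - p i) + (-2 * stepγ t i ω) • fb (t - 1) i ω) -
      2 * inner ℝ (indivGrad ℓ i (x t ω)) (x t ω i - p i) := by
    intro i
    have h1 := h.run.descent ht p i ω
    have hρ := invStep_pos (g := fb) (X := X) (t := t) (i := i) (ω := ω)
    -- The choice `c = 4/ρ` spends one quarter of the drift `ρ‖X_t - X_{t+1}‖²`; the other three
    -- quarters remain in `energyGain`.
    have h2 := inner_young (a := fb t i ω) (b := X t ω i - X (t + 1) ω i)
      (c := 4 / stepρ t i ω) (by positivity)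
    have h3 := sq_div_invStep_le (g := fb) (X := X) (t := t) (i := i) (ω := ω)
    have e1 : 4 / stepρ t i ω * ‖fb t i ω‖ ^ 2 = 4 * (‖fb t i ω‖ ^ 2 / stepρ t i ω) := by ring
    have e2 : ‖X t ω i - X (t + 1) ω i‖ ^ 2 / (4 / stepρ t i ω) =
        1 / 4 * (stepρ t i ω * ‖X t ω i - X (t + 1) ω i‖ ^ 2) := by
      rw [div_div_eq_mul_div]; ring
    rw [e1, e2] at h2
    have e3 : inner ℝ (fb t i ω) (x t ω i - p i) =
        inner ℝ (indivGrad ℓ i (x t ω)) (x t ω i - p i) + inner ℝ (ξ t i ω) (x t ω i - p i) := by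
      rw [feedback_of_pos ht, inner_add_left]
    have e4 : inner ℝ (fb t i ω) (fb (t - 1) i ω) =
        inner ℝ (indivGrad ℓ i (x t ω)) (fb (t - 1) i ω) +
          inner ℝ (ξ t i ω) (fb (t - 1) i ω) := by
      rw [feedback_of_pos ht i ω, inner_add_left]
    rw [e3, e4] at h1
    rw [inner_add_right, inner_smul_right, inner_smul_right]
    linarith
  refine (Finset.sum_le_sum fun i _ => hind i).trans ?_
  rw [Finset.sum_sub_distrib, Finset.sum_add_distrib, Finset.sum_add_distrib,
    ← Finset.mul_sum Finset.univ (fun i => inner ℝ (indivGrad ℓ i (x t ω)) (x t ω i - p i))]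
  linarith

theorem energyGain_bddMeas (h : NoisyRun μ ℓ L σM G B q R ξ X x) (p : JointAction d) {t : ℕ}
    (ht : 1 ≤ t) : BddMeas m0 μ (energyGain ℓ q ξ X x p t) := by
  have hk := h.knowsUntil_ambient (t + 1)
  have hρ := fun i => hk.invStep h.run (Nat.le_add_left 1 t) (Nat.le_succ (t + 1)) i
  have hρ' := fun i =>
    hk.invStep h.run (Nat.le_add_left 1 t) ((Nat.le_succ t).trans (Nat.le_succ (t + 1))) i
  refine BddMeas.sum _ fun i _ => ?_
  refine BddMeas.sub (BddMeas.sub (BddMeas.add (BddMeas.add (BddMeas.sub ?_ ?_) ?_) ?_) ?_) ?_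
  · exact hk.weightedDist h.run p (by omega) le_rfl i
  · exact hk.weightedDist h.run p ht (Nat.le_succ t) i
  · exact (hk.extrapStep h.q_le (by omega) (by omega) i).mul
      (hk.grad h.run h.q_le h.smooth ht (Nat.le_succ t) i).norm_sq
  · exact (BddMeas.const _).mul ((hρ' i).mul ((hk.iterate h.run ht (Nat.le_succ t) i).sub
      (hk.iterate h.run (by omega) le_rfl i)).norm_sq)
  · exact ((hρ i).sub (hρ' i)).mul ((hk.start i).sub (BddMeas.const _)).norm_sq
  · exact (BddMeas.const _).mul (hk.normalizedSq (Nat.lt_succ_self t) i)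

theorem crossError_bddMeas (h : NoisyRun μ ℓ L σM G B q R ξ X x) {t : ℕ} (ht : 1 ≤ t) :
    BddMeas m0 μ (crossError ℓ L G ξ X x t) := by
  have hk := h.knowsUntil_ambient (t + 1)
  refine BddMeas.sum _ fun i _ => BddMeas.add ?_ ?_
  · exact (BddMeas.const _).mul ((BddMeas.const _).min ((BddMeas.const _).mul
      ((hk.iterate h.run ht (Nat.le_succ t) i).sub
        (hk.iterate h.run (by omega) le_rfl i)).norm_sq))
  · exact (BddMeas.const _).mul ((hk.normalizedSq (Nat.lt_succ_self t) i).add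
      (hk.normalizedSq (by omega) i))

theorem play_sub_bddMeas (h : NoisyRun μ ℓ L σM G B q R ξ X x) (p : JointAction d) {t : ℕ}
    (ht : 1 ≤ t) (i : Fin N) : BddMeas (playHistory x t) μ
      (fun ω => (-2 : ℝ) • (x t ω i - p i) + (-2 * stepγ t i ω) • fb (t - 1) i ω) := by
  have hk := h.knowsUntil ht
  exact ((BddMeas.const _).smul (((hk.play h.run h.q_le ht le_rfl).apply i).sub
    (BddMeas.const _))).add (((BddMeas.const _).mul (hk.extrapStep h.q_le ht (by omega) i)).smul
      (hk.feedback _ (by omega) i))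

variable [IsProbabilityMeasure μ]

theorem sum_inner_noise (h : NoisyRun μ ℓ L σM G B q R ξ X x) {t : ℕ} (ht : 1 ≤ t)
    {Y : (i : Fin N) → Ω → Action d i} (hY : ∀ i, BddMeas (playHistory x t) μ (Y i)) :
    Integrable (fun ω => ∑ i, inner ℝ (ξ t i ω) (Y i ω)) μ ∧
      ∫ ω, ∑ i, inner ℝ (ξ t i ω) (Y i ω) ∂μ = 0 := by
  have hI : ∀ i, Integrable (fun ω => inner ℝ (ξ t i ω) (Y i ω)) μ := fun i =>
    ((h.noise_bddMeas ht i).inner ((hY i).mono (h.playHistory_le t))).integrable le_rfl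
  refine ⟨integrable_finsetSum _ fun i _ => hI i, ?_⟩
  rw [integral_finsetSum _ fun i _ => hI i]
  exact Finset.sum_eq_zero fun i _ => integral_inner_eq_zero (h.playHistory_le t)
    (h.noise_bddMeas ht i) (h.noise.unbiased t ht i) (hY i)

/-- Round `1` has no correlation term, since `g_0 = 0`; its `γ‖V‖²` is bounded by `G²` for each
player. -/
theorem integral_energyGain_one_le (h : NoisyRun μ ℓ L σM G B q R ξ X x) {p : JointAction d}
    (hp : IsNash ℓ p) : ∫ ω, energyGain ℓ q ξ X x p 1 ω ∂μ ≤ N * G ^ 2 := by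
  obtain ⟨hI, h0⟩ := h.sum_inner_noise le_rfl (h.play_sub_bddMeas p le_rfl)
  calc ∫ ω, energyGain ℓ q ξ X x p 1 ω ∂μ
      ≤ ∫ ω, (N * G ^ 2 + ∑ i, inner ℝ (ξ 1 i ω) ((-2 : ℝ) • (x 1 ω i - p i) +
        (-2 * stepγ 1 i ω) • fb (1 - 1) i ω)) ∂μ := by
        refine integral_mono ((h.energyGain_bddMeas p le_rfl).integrable le_rfl)
          ((integrable_const _).add hI) fun ω => (h.energyGain_le hp le_rfl ω).trans ?_
        have h1 : ∑ i, stepγ 1 i ω * ‖indivGrad ℓ i (x 1 ω)‖ ^ 2 ≤ ∑ _i : Fin N, G ^ 2 := by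
          refine Finset.sum_le_sum fun i _ => ?_
          have h1 := extrapStep_le_one (g := fb) (t := 1) (i := i) (ω := ω) h.q_le
          have h2 := pow_le_pow_left₀ (norm_nonneg _) (h.bounded.grad_le i (x 1 ω)) 2
          exact (mul_le_of_le_one_left (by positivity) h1).trans h2
        have h2 : ∑ i, -2 * stepγ 1 i ω * inner ℝ (indivGrad ℓ i (x 1 ω)) (fb (1 - 1) i ω) = 0 :=
          Finset.sum_eq_zero fun i _ => by
            rw [Nat.sub_self, feedback_zero, inner_zero_right, mul_zero]
        rw [Finset.sum_const, Finset.card_univ, Fintype.card_fin, nsmul_eq_mul] at h1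
        rw [h2]
        linarith
    _ = N * G ^ 2 := by
        rw [integral_add (integrable_const _) hI, h0]
        simp

/-- Two noises are averaged out against different histories: that of round `t + 1` given `t + 1`
actions, and that of round `t` in the correlation given `t` actions. -/
theorem integral_energyGain_succ_le (h : NoisyRun μ ℓ L σM G B q R ξ X x) {p : JointAction d}
    (hp : IsNash ℓ p) {t : ℕ} (ht : 1 ≤ t) :
    ∫ ω, energyGain ℓ q ξ X x p (t + 1) ω ∂μ ≤ ∫ ω, crossError ℓ L G ξ X x t ω ∂μ := by
  have hk := h.knowsUntil ht
  obtain ⟨hI, h0⟩ := h.sum_inner_noise (Nat.le_add_left 1 t)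
    (h.play_sub_bddMeas p (Nat.le_add_left 1 t))
  obtain ⟨hI', h0'⟩ := h.sum_inner_noise ht
    (Y := fun i ω => (-2 * stepγ (t + 1) i ω) • indivGrad ℓ i (denoised ℓ q ξ X x t ω) +
      (-2 * (L * (4 * N + 1)) * stepγ (t + 1) i ω ^ 2) • indivGrad ℓ i (x t ω)) fun i => by
    have hγ := hk.extrapStep h.q_le ht le_rfl i
    exact (((BddMeas.const _).mul hγ).smul ((hk.denoised h.run h.q_le h.smooth
      ht).comp_continuous (h.smooth.lipschitz i).continuous)).add
      (((BddMeas.const _).mul (hγ.pow 2)).smul (hk.grad h.run h.q_le h.smooth ht le_rfl i))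
  have hcint := (h.crossError_bddMeas ht).integrable le_rfl
  calc ∫ ω, energyGain ℓ q ξ X x p (t + 1) ω ∂μ
      ≤ ∫ ω, (crossError ℓ L G ξ X x t ω +
        ∑ i, inner ℝ (ξ (t + 1) i ω) ((-2 : ℝ) • (x (t + 1) ω i - p i) +
          (-2 * stepγ (t + 1) i ω) • fb (t + 1 - 1) i ω) +
        ∑ i, inner ℝ (ξ t i ω) ((-2 * stepγ (t + 1) i ω) •
          indivGrad ℓ i (denoised ℓ q ξ X x t ω) +
          (-2 * (L * (4 * N + 1)) * stepγ (t + 1) i ω ^ 2) • indivGrad ℓ i (x t ω))) ∂μ := by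
        refine integral_mono ((h.energyGain_bddMeas p (Nat.le_add_left 1 t)).integrable le_rfl)
          ((hcint.add hI).add hI') fun ω =>
            (h.energyGain_le hp (Nat.le_add_left 1 t) ω).trans ?_
        have hc := cross_term_le h.smooth h.bounded.grad_le h.run h.q_pos.le h.q_le ht ω
        rw [Finset.sum_add_distrib] at hc
        simp only [add_assoc (-(_ : ℝ))] at hc
        rw [Finset.sum_add_distrib, Finset.sum_neg_distrib] at hc
        simp only [crossError, Nat.add_sub_cancel] at hc ⊢
        linarith
    _ = _ := by
        refine (integral_add (hcint.add hI) hI').trans ?_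
        rw [integral_add' hcint hI, h0, h0', add_zero, add_zero]

end NoisyRun

end Energy

/-! ### Uniform bounds in expectation -/

theorem sum_Icc_succ_sub (f : ℕ → ℝ) (T : ℕ) :
    ∑ t ∈ Finset.Icc 1 T, (f (t + 1) - f t) = f (T + 1) - f 1 := by
  induction T with
  | zero => simp
  | succ T ih => rw [Finset.sum_Icc_succ_top (by omega), ih]; ring

theorem sum_Icc_pred_le {f : ℕ → ℝ} (hf : ∀ t, 0 ≤ f t) (hf0 : f 0 = 0) (T : ℕ) :
    ∑ t ∈ Finset.Icc 1 T, f (t - 1) ≤ ∑ t ∈ Finset.Icc 1 T, f t := by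
  have h : ∑ t ∈ Finset.Icc 1 T, f (t - 1) + f T = ∑ t ∈ Finset.Icc 1 T, f t := by
    induction T with
    | zero => simp [hf0]
    | succ T ih =>
      rw [Finset.sum_Icc_succ_top (by omega), Finset.sum_Icc_succ_top (by omega),
        Nat.add_sub_cancel, ih]
  linarith [hf T]

section Bounds

variable {N : ℕ} {d : Fin N → ℕ} {Ω : Type*} {m0 : MeasurableSpace Ω} {μ : Measure Ω}
  {ℓ : Fin N → JointAction d → ℝ} {L : ℝ≥0} {σM G B q R : ℝ}
  {ξ : ℕ → (i : Fin N) → Ω → Action d i} {X x : ℕ → Ω → JointAction d}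

/-- The inverse update step size without delay. -/
noncomputable def stepWeight (g : ℕ → (i : Fin N) → Ω → Action d i) (X : ℕ → Ω → JointAction d)
    (t : ℕ) (i : Fin N) (ω : Ω) : ℝ :=
  √(1 + cumSq g t i ω + pathSq X t i ω)

local notation "fb" => feedback ℓ x ξ
local notation "stepγ" => extrapStep q (feedback ℓ x ξ)
local notation "stepρ" => invStep (feedback ℓ x ξ) X
local notation "nsq" => normalizedSq (feedback ℓ x ξ)
local notation "wt" => stepWeight (feedback ℓ x ξ) X

theorem sum_normalizedSq_le {ω : Ω} {M : ℝ} (hfb : ∀ t i, ‖fb t i ω‖ ≤ M) (i : Fin N) (T : ℕ) :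
    ∑ t ∈ Finset.Icc 1 T, nsq t i ω ≤ 2 * √(1 + 2 * M ^ 2) * wt T i ω := by
  refine (sum_div_sqrt_delayed_le (a := fun t => ‖fb t i ω‖ ^ 2) (fun t => by positivity)
    (fun t => pow_le_pow_left₀ (norm_nonneg _) (hfb t i) 2) T).trans ?_
  refine mul_le_mul_of_nonneg_left (Real.sqrt_le_sqrt ?_) (by positivity)
  have := pathSq_nonneg (X := X) (t := T) (i := i) (ω := ω)
  simp only [cumSq]
  linarith

theorem norm_init_sub_sq_le {ω : Ω} (hR : ‖X 1 ω‖ ≤ R) (p : JointAction d) (i : Fin N) :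
    ‖X 1 ω i - p i‖ ^ 2 ≤ (R + ‖p‖) ^ 2 := by
  refine pow_le_pow_left₀ (norm_nonneg _) ?_ 2
  have h1 := PiLp.norm_apply_le (X 1 ω) i
  have h2 := PiLp.norm_apply_le p i
  linarith [norm_sub_le (X 1 ω i) (p i)]

theorem invStep_succ_le_weight {t : ℕ} {i : Fin N} {ω : Ω} : stepρ (t + 1) i ω ≤ wt t i ω := by
  have h1 := cumSq_mono (g := fb) (i := i) (ω := ω) (show t + 1 - 2 ≤ t by omega)
  have h2 := pathSq_mono (X := X) (i := i) (ω := ω) (show t + 1 - 2 ≤ t by omega)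
  exact Real.sqrt_le_sqrt (by simp only at h1 h2; linarith)

theorem sum_step_init_le {ω : Ω} (hR : ‖X 1 ω‖ ≤ R) (p : JointAction d) (i : Fin N) (T : ℕ) :
    ∑ t ∈ Finset.Icc 1 T, (stepρ (t + 1) i ω - stepρ t i ω) * ‖X 1 ω i - p i‖ ^ 2 ≤
      (R + ‖p‖) ^ 2 * wt T i ω := by
  rw [← Finset.sum_mul, sum_Icc_succ_sub (fun t => stepρ t i ω), mul_comm]
  have h1 := invStep_succ_le_weight (ℓ := ℓ) (x := x) (ξ := ξ) (X := X) (t := T) (i := i) (ω := ω)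
  have h2 := invStep_pos (g := fb) (X := X) (t := 1) (i := i) (ω := ω)
  refine mul_le_mul (norm_init_sub_sq_le hR p i) (by linarith) ?_ (by positivity)
  have := invStep_mono (g := fb) (X := X) (i := i) (ω := ω) (Nat.le_add_left 1 T)
  simp only at this
  linarith

/-- Summed over rounds, the distances telescope and the step-size increments, like the normalized
feedback, cost a multiple of `wt`. The cross errors are subtracted because their counterpart appears
in the expectation of the gains. -/
theorem energy_pathwise {ω : Ω} {M : ℝ} (hfb : ∀ t i, ‖fb t i ω‖ ≤ M)
    (hR : ‖X 1 ω‖ ≤ R) (p : JointAction d) (T : ℕ) :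
    ∑ i, (∑ t ∈ Finset.Icc 1 T, stepγ t i ω * ‖indivGrad ℓ i (x t ω)‖ ^ 2 +
        pathSq X T i ω / 4) ≤
      ∑ t ∈ Finset.Icc 1 T, energyGain ℓ q ξ X x p t ω -
        ∑ t ∈ Finset.Icc 1 T, crossError ℓ L G ξ X x t ω +
      N * ((R + ‖p‖) ^ 2 + (4 * (N * (3 * L ^ 2)) ^ 3 + 2 * (N * (4 * G ^ 2)))) +
      ((R + ‖p‖) ^ 2 + (4 + 2 * (3 * L ^ 2 * N + L * (4 * N + 1))) * (2 * √(1 + 2 * M ^ 2))) *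
        ∑ i, wt T i ω := by
  simp only [energyGain, crossError]
  have eN : ∀ K : ℝ, N * K = ∑ _i : Fin N, K := fun K => by simp
  rw [Finset.sum_comm (s := Finset.Icc 1 T), Finset.sum_comm (s := Finset.Icc 1 T),
    Finset.mul_sum, eN ((R + ‖p‖) ^ 2 + _), ← Finset.sum_sub_distrib, ← Finset.sum_add_distrib,
    ← Finset.sum_add_distrib]
  refine Finset.sum_le_sum fun i _ => ?_
  have hu := sum_Icc_succ_sub (fun t => weightedDist fb X p t i ω) T
  have hu0 := weightedDist_nonneg (ℓ := ℓ) (x := x) (ξ := ξ) (X := X) (p := p) (t := T + 1)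
    (i := i) (ω := ω)
  have hu1 : weightedDist fb X p 1 i ω ≤ (R + ‖p‖) ^ 2 := by
    have h1 : stepρ 1 i ω = 1 := by simp [invStep, cumSq, pathSq]
    rw [weightedDist, h1, one_mul]
    exact norm_init_sub_sq_le hR p i
  have hδ := sum_step_init_le (ℓ := ℓ) (x := x) (ξ := ξ) hR p i T
  have hn := sum_normalizedSq_le (ℓ := ℓ) (x := x) (ξ := ξ) (X := X) hfb i T
  have hn' := sum_Icc_pred_le (f := fun t => nsq t i ω) (fun t => normalizedSq_nonneg)
    (normalizedSq_zero i ω) T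
  have hmin := sum_min_sub_le (a := fun t => ‖X t ω i - X (t + 1) ω i‖ ^ 2)
    (A := N * (4 * G ^ 2)) (K := N * (3 * L ^ 2)) (fun t => by positivity) (by positivity)
    (by positivity) T
  -- The drift `3/4 ρ` is split: `ρ ≥ 1` on one quarter yields the `pathSq / 4` of the conclusion,
  -- and `ρ ≥ √(1 + pathSq)` on the remaining half feeds `sum_min_sub_le`.
  have hdrift : ∑ t ∈ Finset.Icc 1 T,
      (‖X t ω i - X (t + 1) ω i‖ ^ 2 / 4 + (N * min (4 * G ^ 2)
        (3 * L ^ 2 * ‖X t ω i - X (t + 1) ω i‖ ^ 2) -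
        3 / 4 * (stepρ t i ω * ‖X t ω i - X (t + 1) ω i‖ ^ 2))) ≤
      4 * (N * (3 * (L : ℝ) ^ 2)) ^ 3 + 2 * (N * (4 * G ^ 2)) := by
    refine le_trans (Finset.sum_le_sum fun t _ => ?_) hmin
    have h1 := one_le_invStep (g := fb) (X := X) (t := t) (i := i) (ω := ω)
    have h2 := sqrt_pathSq_le_invStep (g := fb) (X := X) (t := t) (i := i) (ω := ω)
    have h3 : 0 ≤ ‖X t ω i - X (t + 1) ω i‖ ^ 2 := by positivity
    rw [mul_min_of_nonneg _ _ (Nat.cast_nonneg N), ← mul_assoc (N : ℝ) (3 * (L : ℝ) ^ 2)]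
    simp only [pathSq] at h2
    nlinarith [mul_le_mul_of_nonneg_left h1 h3, mul_le_mul_of_nonneg_left h2 h3]
  simp only [Finset.sum_add_distrib, Finset.sum_sub_distrib, ← Finset.mul_sum, ← Finset.sum_div]
    at hu hdrift hn' ⊢
  simp only [← Finset.sum_mul, Finset.sum_sub_distrib] at hδ ⊢
  set c1 : ℝ := 3 * L ^ 2 * N + L * (4 * N + 1) with hc1
  have hc0 : 0 ≤ c1 := by positivity
  have hb1 := mul_le_mul_of_nonneg_left hn hc0
  have hb2 := mul_le_mul_of_nonneg_left hn' hc0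
  rw [pathSq]
  linarith

/-! ### Closing the estimate in expectation -/

namespace NoisyRun

variable [IsProbabilityMeasure μ]

theorem integrable_gradEnergy (h : NoisyRun μ ℓ L σM G B q R ξ X x) (i : Fin N) (T : ℕ) :
    Integrable (fun ω => ∑ t ∈ Finset.Icc 1 T, stepγ t i ω * ‖indivGrad ℓ i (x t ω)‖ ^ 2) μ := by
  refine (BddMeas.sum _ fun t ht => ?_ : BddMeas m0 μ _).integrable le_rfl
  have ht := Finset.mem_Icc.1 ht
  have hk := h.knowsUntil_ambient (T + 1)
  exact (hk.extrapStep h.q_le (by omega) (by omega) i).mul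
    (hk.grad h.run h.q_le h.smooth ht.1 (by omega) i).norm_sq

theorem integrable_feedbackEnergy (h : NoisyRun μ ℓ L σM G B q R ξ X x) (i : Fin N) (T : ℕ) :
    Integrable (fun ω => ∑ t ∈ Finset.Icc 1 T, stepγ t i ω * ‖fb t i ω‖ ^ 2) μ := by
  refine (BddMeas.sum _ fun t ht => ?_ : BddMeas m0 μ _).integrable le_rfl
  have ht := Finset.mem_Icc.1 ht
  have hk := h.knowsUntil_ambient (T + 1)
  exact (hk.extrapStep h.q_le (by omega) (by omega) i).mul
    (hk.feedback t (by omega) i).norm_sq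

theorem integrable_pathSq (h : NoisyRun μ ℓ L σM G B q R ξ X x) (i : Fin N) (T : ℕ) :
    Integrable (pathSq X T i) μ :=
  ((h.knowsUntil_ambient (T + 1)).pathSq h.run (Nat.lt_succ_self T) i).integrable le_rfl

theorem integrable_weight (h : NoisyRun μ ℓ L σM G B q R ξ X x) (i : Fin N) (T : ℕ) :
    Integrable (wt T i) μ := by
  have hk := h.knowsUntil_ambient (T + 1)
  exact (((BddMeas.const 1).add (hk.cumSq (Nat.lt_succ_self T) i)).add
    (hk.pathSq h.run (Nat.lt_succ_self T) i)).sqrt.integrable le_rfl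

theorem sum_integral_energyGain_le (h : NoisyRun μ ℓ L σM G B q R ξ X x) {p : JointAction d}
    (hp : IsNash ℓ p) (T : ℕ) :
    ∑ t ∈ Finset.Icc 1 T, ∫ ω, energyGain ℓ q ξ X x p t ω ∂μ ≤
      N * G ^ 2 + ∑ t ∈ Finset.Icc 1 T, ∫ ω, crossError ℓ L G ξ X x t ω ∂μ := by
  have hnn : ∀ t, 0 ≤ ∫ ω, crossError ℓ L G ξ X x t ω ∂μ := fun t =>
    integral_nonneg fun ω => crossError_nonneg
  -- The gain of round `t + 1` is paid by the cross error of round `t`, so the two sums are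
  -- naturally offset by one.
  have key : ∀ T, ∑ t ∈ Finset.Icc 1 (T + 1), ∫ ω, energyGain ℓ q ξ X x p t ω ∂μ ≤
      N * G ^ 2 + ∑ t ∈ Finset.Icc 1 T, ∫ ω, crossError ℓ L G ξ X x t ω ∂μ := by
    intro T
    induction T with
    | zero => simpa using h.integral_energyGain_one_le hp
    | succ T ih =>
      rw [Finset.sum_Icc_succ_top (by omega), Finset.sum_Icc_succ_top (by omega : 1 ≤ T + 1)
        (fun t => ∫ ω, crossError ℓ L G ξ X x t ω ∂μ)]
      linarith [h.integral_energyGain_succ_le hp (Nat.le_add_left 1 T)]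
  match T with
  | 0 => simp; positivity
  | T + 1 =>
    refine (key T).trans (add_le_add_right ?_ _)
    rw [Finset.sum_Icc_succ_top (by omega)]
    linarith [hnn (T + 1)]

theorem exists_energy_le (h : NoisyRun μ ℓ L σM G B q R ξ X x) :
    ∃ C₀ C₁ : ℝ, 0 ≤ C₁ ∧ ∀ T : ℕ,
      ∑ i, (∫ ω, ∑ t ∈ Finset.Icc 1 T, stepγ t i ω * ‖indivGrad ℓ i (x t ω)‖ ^ 2 ∂μ +
        (∫ ω, pathSq X T i ω ∂μ) / 4) ≤ C₀ + C₁ * ∑ i, ∫ ω, wt T i ω ∂μ := by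
  obtain ⟨p, hp⟩ := h.stable.exists_nash
  refine ⟨N * G ^ 2 +
    N * ((R + ‖p‖) ^ 2 + (4 * (N * (3 * L ^ 2)) ^ 3 + 2 * (N * (4 * G ^ 2)))),
    (R + ‖p‖) ^ 2 + (4 + 2 * (3 * L ^ 2 * N + L * (4 * N + 1))) *
      (2 * √(1 + 2 * (|G| + |B|) ^ 2)), by positivity, fun T => ?_⟩
  set C₁ := (R + ‖p‖) ^ 2 + (4 + 2 * (3 * L ^ 2 * N + L * (4 * N + 1))) *
      (2 * √(1 + 2 * (|G| + |B|) ^ 2)) with hC₁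
  set C₀ := N * ((R + ‖p‖) ^ 2 + (4 * (N * (3 * (L : ℝ) ^ 2)) ^ 3 + 2 * (N * (4 * G ^ 2))))
    with hC₀
  have hgain : ∀ t ∈ Finset.Icc 1 T, Integrable (energyGain ℓ q ξ X x p t) μ := fun t ht =>
    (h.energyGain_bddMeas p (Finset.mem_Icc.1 ht).1).integrable le_rfl
  have hcross : ∀ t ∈ Finset.Icc 1 T, Integrable (crossError ℓ L G ξ X x t) μ := fun t ht =>
    (h.crossError_bddMeas (Finset.mem_Icc.1 ht).1).integrable le_rfl
  have hmono : ∫ ω, (∑ i, (∑ t ∈ Finset.Icc 1 T, stepγ t i ω * ‖indivGrad ℓ i (x t ω)‖ ^ 2 +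
        pathSq X T i ω / 4)) ∂μ ≤
      ∫ ω, (∑ t ∈ Finset.Icc 1 T, energyGain ℓ q ξ X x p t ω -
        ∑ t ∈ Finset.Icc 1 T, crossError ℓ L G ξ X x t ω + C₀ + C₁ * ∑ i, wt T i ω) ∂μ := by
    refine integral_mono_ae ?_ ?_ ?_
    · exact integrable_finsetSum _ fun i _ =>
        (h.integrable_gradEnergy i T).add ((h.integrable_pathSq i T).div_const 4)
    · exact (((integrable_finsetSum _ hgain).sub (integrable_finsetSum _ hcross)).add
        (integrable_const _)).add
          ((integrable_finsetSum _ fun i _ => h.integrable_weight i T).const_mul _)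
    · filter_upwards [h.ae_feedback_le, h.init_le] with ω h1 h2
      exact energy_pathwise h1 h2 p T
  have e1 : ∫ ω, (∑ i, (∑ t ∈ Finset.Icc 1 T, stepγ t i ω * ‖indivGrad ℓ i (x t ω)‖ ^ 2 +
        pathSq X T i ω / 4)) ∂μ =
      ∑ i, (∫ ω, ∑ t ∈ Finset.Icc 1 T, stepγ t i ω * ‖indivGrad ℓ i (x t ω)‖ ^ 2 ∂μ +
        (∫ ω, pathSq X T i ω ∂μ) / 4) := by
    refine (integral_finsetSum _ fun i _ =>
      (h.integrable_gradEnergy i T).add ((h.integrable_pathSq i T).div_const 4)).trans ?_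
    refine Finset.sum_congr rfl fun i _ => ?_
    rw [integral_add' (h.integrable_gradEnergy i T) ((h.integrable_pathSq i T).div_const 4),
      integral_div]
  have e2 : ∫ ω, (∑ t ∈ Finset.Icc 1 T, energyGain ℓ q ξ X x p t ω -
        ∑ t ∈ Finset.Icc 1 T, crossError ℓ L G ξ X x t ω + C₀ + C₁ * ∑ i, wt T i ω) ∂μ =
      ∑ t ∈ Finset.Icc 1 T, ∫ ω, energyGain ℓ q ξ X x p t ω ∂μ -
        ∑ t ∈ Finset.Icc 1 T, ∫ ω, crossError ℓ L G ξ X x t ω ∂μ + C₀ +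
        C₁ * ∑ i, ∫ ω, wt T i ω ∂μ := by
    have i1 := integrable_finsetSum _ hgain
    have i2 := integrable_finsetSum _ hcross
    have i3 := (integrable_finsetSum Finset.univ fun i _ => h.integrable_weight i T).const_mul C₁
    refine (integral_add ((i1.sub i2).add (integrable_const C₀)) i3).trans ?_
    rw [integral_const_mul, integral_finsetSum _ fun i _ => h.integrable_weight i T,
      ← integral_finsetSum _ hgain, ← integral_finsetSum _ hcross]
    congr 1
    refine (integral_add (i1.sub i2) (integrable_const C₀)).trans ?_
    rw [integral_sub' i1 i2]
    simp
  rw [e1, e2] at hmono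
  linarith [h.sum_integral_energyGain_le hp T]

/-- `γ_t` is known before `ξ_t`, so it passes through the conditional variance bound. Purely
multiplicative noise is essential: an additive variance would leave a term growing with `∑ γ`. -/
theorem integral_feedbackEnergy_le (h : NoisyRun μ ℓ L σM G B q R ξ X x) (i : Fin N) (T : ℕ) :
    ∫ ω, ∑ t ∈ Finset.Icc 1 T, stepγ t i ω * ‖fb t i ω‖ ^ 2 ∂μ ≤
      (1 + σM ^ 2) *
        ∫ ω, ∑ t ∈ Finset.Icc 1 T, stepγ t i ω * ‖indivGrad ℓ i (x t ω)‖ ^ 2 ∂μ := by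
  have hk := h.knowsUntil_ambient (T + 1)
  have hγ : ∀ t ∈ Finset.Icc 1 T, BddMeas m0 μ (stepγ t i) := fun t ht =>
    hk.extrapStep h.q_le (by omega) (by have := (Finset.mem_Icc.1 ht).2; omega) i
  have hV : ∀ t ∈ Finset.Icc 1 T, BddMeas m0 μ (fun ω => indivGrad ℓ i (x t ω)) := fun t ht =>
    hk.grad h.run h.q_le h.smooth (Finset.mem_Icc.1 ht).1
      (by have := (Finset.mem_Icc.1 ht).2; omega) i
  have hf : ∀ t ∈ Finset.Icc 1 T, BddMeas m0 μ (fb t i) := fun t ht =>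
    hk.feedback t (by have := (Finset.mem_Icc.1 ht).2; omega) i
  rw [integral_finsetSum _ fun t ht => ((hγ t ht).mul (hf t ht).norm_sq).integrable le_rfl,
    integral_finsetSum _ fun t ht => ((hγ t ht).mul (hV t ht).norm_sq).integrable le_rfl,
    Finset.mul_sum]
  refine Finset.sum_le_sum fun t ht => ?_
  have ht1 := (Finset.mem_Icc.1 ht).1
  have hξ := h.noise_bddMeas ht1 i
  have hkF := h.knowsUntil ht1
  have hγF := hkF.extrapStep h.q_le ht1 (Nat.le_succ t) i
  have hVF := hkF.grad h.run h.q_le h.smooth ht1 le_rfl i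
  have i1 := ((hγ t ht).mul (hV t ht).norm_sq).integrable le_rfl
  have i2 := ((hγ t ht).mul hξ.norm_sq).integrable le_rfl
  have i3 := (hξ.inner (((BddMeas.const 2).mul (hγ t ht)).smul (hV t ht))).integrable le_rfl
  have e : ∀ ω, stepγ t i ω * ‖fb t i ω‖ ^ 2 =
      stepγ t i ω * ‖indivGrad ℓ i (x t ω)‖ ^ 2 + stepγ t i ω * ‖ξ t i ω‖ ^ 2 +
        inner ℝ (ξ t i ω) ((2 * stepγ t i ω) • indivGrad ℓ i (x t ω)) := by
    intro ω
    rw [feedback_of_pos ht1 i ω, norm_add_sq_real, inner_smul_right, real_inner_comm (ξ t i ω)]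
    ring
  have h0 := integral_inner_eq_zero (h.playHistory_le t) hξ (h.noise.unbiased t ht1 i)
    (((BddMeas.const 2).mul hγF).smul hVF)
  have hvar := integral_mul_le_of_condExp_le (h.playHistory_le t) hξ.norm_sq
    ((BddMeas.const (0 ^ 2)).add ((BddMeas.const (σM ^ 2)).mul hVF.norm_sq)) hγF
    (fun ω => extrapStep_pos.le) (h.noise.variance t ht1 i)
  have e3 : ∫ ω, stepγ t i ω * (0 ^ 2 + σM ^ 2 * ‖indivGrad ℓ i (x t ω)‖ ^ 2) ∂μ =
      σM ^ 2 * ∫ ω, stepγ t i ω * ‖indivGrad ℓ i (x t ω)‖ ^ 2 ∂μ := by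
    rw [← integral_const_mul]
    exact integral_congr_ae (ae_of_all _ fun ω => by ring)
  simp only [e]
  have e4 : ∫ ω, (stepγ t i ω * ‖indivGrad ℓ i (x t ω)‖ ^ 2 + stepγ t i ω * ‖ξ t i ω‖ ^ 2 +
      inner ℝ (ξ t i ω) ((2 * stepγ t i ω) • indivGrad ℓ i (x t ω))) ∂μ =
      ∫ ω, stepγ t i ω * ‖indivGrad ℓ i (x t ω)‖ ^ 2 ∂μ + ∫ ω, stepγ t i ω * ‖ξ t i ω‖ ^ 2 ∂μ +
      ∫ ω, inner ℝ (ξ t i ω) ((2 * stepγ t i ω) • indivGrad ℓ i (x t ω)) ∂μ := by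
    refine (integral_add (i1.add i2) i3).trans ?_
    rw [integral_add' i1 i2]
  rw [e4, h0]
  rw [e3] at hvar
  linarith

/-- The root splits into `√(1 + λ)` and `√μ`. The first is negligible against `(1 + λ)^{1/2+q}`,
thus against `∑ γ‖g‖²`; the second is negligible against `μ`. -/
theorem exists_weight_le (hq0 : 0 < q) (hq1 : q ≤ 1 / 4) {ε : ℝ} (hε : 0 < ε) :
    ∃ C : ℝ, ∀ (T : ℕ) (i : Fin N) (ω : Ω), wt T i ω ≤
      ε * (∑ t ∈ Finset.Icc 1 T, stepγ t i ω * ‖fb t i ω‖ ^ 2) + ε * pathSq X T i ω + C := by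
  obtain ⟨C, hC0, hC⟩ := exists_sqrt_le_rpow hq0 hε
  refine ⟨ε + C + 1 / ε, fun T i ω => ?_⟩
  have h1 := cumSq_nonneg (g := fb) (t := T) (i := i) (ω := ω)
  have h2 := pathSq_nonneg (X := X) (t := T) (i := i) (ω := ω)
  have h3 : wt T i ω ≤ √(1 + cumSq fb T i ω) + √(pathSq X T i ω) := by
    refine Real.sqrt_le_iff.2 ⟨by positivity, ?_⟩
    have s1 := Real.sq_sqrt (show 0 ≤ 1 + cumSq fb T i ω by linarith)
    have s2 := Real.sq_sqrt h2
    nlinarith [mul_nonneg (Real.sqrt_nonneg (1 + cumSq fb T i ω))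
      (Real.sqrt_nonneg (pathSq X T i ω))]
  have h4 := hC (1 + cumSq fb T i ω) (by linarith)
  have h5 := sqrt_le_mul_add hε h2
  have h6 := rpow_sub_one_le_sum (a := fun t => ‖fb t i ω‖ ^ 2) (q := q)
    (fun t => by positivity) (by linarith) T
  have h7 : (1 + cumSq fb T i ω) ^ (1 / 2 + q) - 1 ≤
      ∑ t ∈ Finset.Icc 1 T, stepγ t i ω * ‖fb t i ω‖ ^ 2 := h6
  nlinarith [mul_le_mul_of_nonneg_left h7 hε.le]

theorem exists_uniform_bound (h : NoisyRun μ ℓ L σM G B q R ξ X x) :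
    ∃ C : ℝ, ∀ T : ℕ,
      ∑ i, ∫ ω, ∑ t ∈ Finset.Icc 1 T, stepγ t i ω * ‖indivGrad ℓ i (x t ω)‖ ^ 2 ∂μ ≤ C ∧
      ∑ i, ∫ ω, ∑ t ∈ Finset.Icc 1 T, stepγ t i ω * ‖fb t i ω‖ ^ 2 ∂μ ≤ C ∧
      ∑ i, ∫ ω, wt T i ω ∂μ ≤ C := by
  obtain ⟨C₀, C₁, hC₁, hE⟩ := h.exists_energy_le
  have hσ : 0 < 1 + σM ^ 2 := by positivity
  obtain ⟨C₂, hW⟩ := exists_weight_le (ℓ := ℓ) (X := X) (x := x) (ξ := ξ) h.q_pos h.q_le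
    (ε := 1 / (8 * (1 + σM ^ 2) * (1 + C₁))) (by positivity)
  -- With this `ε`, the right side of the energy bound returns at most `A/8 + P/8`, against `A +
  -- P/4` on the left; hence the factor `8` in `hAP`.
  set ε := 1 / (8 * (1 + σM ^ 2) * (1 + C₁)) with hεdef
  have hε : 0 < ε := by positivity
  have hε1 : 8 * (1 + σM ^ 2) * (C₁ * ε) ≤ 1 := by
    rw [hεdef, mul_one_div, mul_div_assoc', div_le_one (by positivity)]
    nlinarith
  have hε2 : C₁ * ε * (1 + σM ^ 2) ≤ 1 / 8 := by linarith
  have hε3 : C₁ * ε ≤ 1 / 8 := by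
    have : 0 ≤ C₁ * ε := by positivity
    nlinarith [sq_nonneg σM]
  have hε4 : ε * (1 + σM ^ 2) ≤ 1 := by
    rw [hεdef, div_mul_eq_mul_div, one_mul, div_le_one (by positivity)]
    nlinarith
  have hε5 : ε ≤ 1 := by nlinarith [sq_nonneg σM]
  have hVnn : ∀ T i, 0 ≤ ∫ ω, ∑ t ∈ Finset.Icc 1 T,
      stepγ t i ω * ‖indivGrad ℓ i (x t ω)‖ ^ 2 ∂μ := fun T i =>
    integral_nonneg fun ω => Finset.sum_nonneg fun t _ =>
      mul_nonneg extrapStep_pos.le (by positivity)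
  have hμnn : ∀ T i, 0 ≤ ∫ ω, pathSq X T i ω ∂μ := fun T i =>
    integral_nonneg fun ω => pathSq_nonneg
  have hWint : ∀ T i, ∫ ω, wt T i ω ∂μ ≤ ε * (1 + σM ^ 2) *
      ∫ ω, ∑ t ∈ Finset.Icc 1 T, stepγ t i ω * ‖indivGrad ℓ i (x t ω)‖ ^ 2 ∂μ +
      ε * ∫ ω, pathSq X T i ω ∂μ + C₂ := by
    intro T i
    have i1 := (h.integrable_feedbackEnergy i T).const_mul ε
    have i2 := (h.integrable_pathSq i T).const_mul ε
    have h1 := integral_mono (h.integrable_weight i T) ((i1.add i2).add (integrable_const C₂))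
      (fun ω => hW T i ω)
    have h2 : ∫ ω, (((fun ω => ε * ∑ t ∈ Finset.Icc 1 T, stepγ t i ω * ‖fb t i ω‖ ^ 2) +
        (fun ω => ε * pathSq X T i ω) + fun _ => C₂ : Ω → ℝ)) ω ∂μ =
        ε * (∫ ω, ∑ t ∈ Finset.Icc 1 T, stepγ t i ω * ‖fb t i ω‖ ^ 2 ∂μ) +
        ε * (∫ ω, pathSq X T i ω ∂μ) + C₂ := by
      rw [integral_add' (i1.add i2) (integrable_const C₂), integral_add' i1 i2,
        integral_const_mul, integral_const_mul]
      simp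
    have h3 := mul_le_mul_of_nonneg_left (h.integral_feedbackEnergy_le i T) hε.le
    refine h1.trans (h2.le.trans ?_)
    linarith
  refine ⟨(1 + σM ^ 2) * (8 * |C₀ + C₁ * (N * C₂)|) + N * |C₂|, fun T => ?_⟩
  set A := ∑ i, ∫ ω, ∑ t ∈ Finset.Icc 1 T,
    stepγ t i ω * ‖indivGrad ℓ i (x t ω)‖ ^ 2 ∂μ with hA
  set P := ∑ i, ∫ ω, pathSq X T i ω ∂μ with hP
  have hA0 : 0 ≤ A := Finset.sum_nonneg fun i _ => hVnn T i
  have hP0 : 0 ≤ P := Finset.sum_nonneg fun i _ => hμnn T i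
  have hWsum : ∑ i, ∫ ω, wt T i ω ∂μ ≤ ε * (1 + σM ^ 2) * A + ε * P + N * C₂ := by
    refine (Finset.sum_le_sum fun i _ => hWint T i).trans (le_of_eq ?_)
    rw [Finset.sum_add_distrib, Finset.sum_add_distrib, ← Finset.mul_sum, ← Finset.mul_sum]
    simp [hA, hP]
  have hEsum : A + P / 4 ≤ C₀ + C₁ * ∑ i, ∫ ω, wt T i ω ∂μ := by
    refine le_trans (le_of_eq ?_) (hE T)
    rw [Finset.sum_add_distrib, ← Finset.sum_div]
  have hAP : A + P ≤ 8 * |C₀ + C₁ * (N * C₂)| := by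
    have h1 := mul_le_mul_of_nonneg_left hWsum hC₁
    have h2 := mul_le_mul_of_nonneg_right hε2 hA0
    have h3 := mul_le_mul_of_nonneg_right hε3 hP0
    have h4 := le_abs_self (C₀ + C₁ * (N * C₂))
    linarith
  have habs : 0 ≤ 8 * |C₀ + C₁ * (N * C₂)| := by positivity
  have hN : N * C₂ ≤ N * |C₂| := mul_le_mul_of_nonneg_left (le_abs_self _) (Nat.cast_nonneg N)
  have hN0 : 0 ≤ N * |C₂| := by positivity
  have hσA : 0 ≤ σM ^ 2 * (8 * |C₀ + C₁ * (N * C₂)|) := by positivity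
  refine ⟨by linarith, ?_, ?_⟩
  · have h1 : ∑ i, ∫ ω, ∑ t ∈ Finset.Icc 1 T, stepγ t i ω * ‖fb t i ω‖ ^ 2 ∂μ ≤
        (1 + σM ^ 2) * A := by
      rw [hA, Finset.mul_sum]
      exact Finset.sum_le_sum fun i _ => h.integral_feedbackEnergy_le i T
    have h2 := mul_le_mul_of_nonneg_left (show A ≤ 8 * |C₀ + C₁ * (N * C₂)| by linarith) hσ.le
    linarith
  · have h1 := mul_le_mul_of_nonneg_right hε4 hA0
    have h2 := mul_le_mul_of_nonneg_right hε5 hP0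
    linarith

end NoisyRun

end Bounds

/-! ### Almost sure convergence -/

section Opial

variable {N : ℕ} {d : Fin N → ℕ}

/-- Opial's argument for convergent weights: if the weighted distances to a dense family of points
of `S` converge and all cluster points lie in `S`, then the sequence converges to a point of `S`. -/
theorem exists_tendsto_of_weighted_dist {Z P : ℕ → JointAction d} {w : ℕ → Fin N → ℝ}
    {w' : Fin N → ℝ} {S : Set (JointAction d)}
    (hw : ∀ i, Tendsto (fun t => w t i) atTop (𝓝 (w' i))) (hw' : ∀ i, 0 < w' i)
    (hP : ∀ z ∈ S, ∀ δ > 0, ∃ n, dist z (P n) < δ)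
    (hconv : ∀ n, ∃ l, Tendsto (fun t => ∑ i, w t i * ‖Z t i - P n i‖ ^ 2) atTop (𝓝 l))
    (hcl : ∀ z, MapClusterPt z atTop Z → z ∈ S) : ∃ z ∈ S, Tendsto Z atTop (𝓝 z) := by
  -- Eventually all weights lie between `c` and `C`, so the weighted and Euclidean distances are
  -- comparable.
  obtain ⟨c, hcw, hc⟩ : ∃ c : ℝ, (∀ i, c < w' i) ∧ 0 < c := by
    have h1 : ∀ᶠ c : ℝ in 𝓝[>] 0, ∀ i, c < w' i :=
      eventually_all.2 fun i => mem_nhdsWithin_of_mem_nhds (Iio_mem_nhds (hw' i))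
    exact (h1.and self_mem_nhdsWithin).exists
  obtain ⟨C, hCw, hC⟩ : ∃ C : ℝ, (∀ i, w' i < C) ∧ 0 < C :=
    ((eventually_all.2 fun i => eventually_gt_atTop (w' i)).and (eventually_gt_atTop 0)).exists
  have hlow : ∀ᶠ t in atTop, ∀ i, c ≤ w t i :=
    eventually_all.2 fun i => ((hw i).eventually (lt_mem_nhds (hcw i))).mono fun _ h => h.le
  have hupp : ∀ᶠ t in atTop, ∀ i, w t i ≤ C :=
    eventually_all.2 fun i => ((hw i).eventually (gt_mem_nhds (hCw i))).mono fun _ h => h.le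
  have hlow' : ∀ n, ∀ᶠ t in atTop, c * ‖Z t - P n‖ ^ 2 ≤ ∑ i, w t i * ‖Z t i - P n i‖ ^ 2 := by
    intro n
    filter_upwards [hlow] with t ht
    rw [PiLp.norm_sq_eq_of_L2, Finset.mul_sum]
    exact Finset.sum_le_sum fun i _ => mul_le_mul_of_nonneg_right (ht i) (by positivity)
  have hupp' : ∀ n, ∀ᶠ t in atTop, ∑ i, w t i * ‖Z t i - P n i‖ ^ 2 ≤ C * ‖Z t - P n‖ ^ 2 := by
    intro n
    filter_upwards [hupp] with t ht
    rw [PiLp.norm_sq_eq_of_L2, Finset.mul_sum]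
    exact Finset.sum_le_sum fun i _ => mul_le_mul_of_nonneg_right (ht i) (by positivity)
  obtain ⟨z, hz⟩ : ∃ z, MapClusterPt z atTop Z := by
    obtain ⟨l, hl⟩ := hconv 0
    have hb : ∀ᶠ t in atTop, Z t ∈ Metric.closedBall (P 0) ((l + 1) / c + 1) := by
      filter_upwards [hlow' 0, hl.eventually (gt_mem_nhds (lt_add_one l))] with t h1 h2
      rw [Metric.mem_closedBall, dist_eq_norm]
      have h3 : ‖Z t - P 0‖ ^ 2 ≤ (l + 1) / c := by
        rw [le_div_iff₀ hc]; linarith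
      nlinarith [sq_nonneg (‖Z t - P 0‖ - 1 / 2)]
    obtain ⟨z, -, hz⟩ := (isCompact_closedBall (P 0) ((l + 1) / c + 1)).exists_mapClusterPt
      (le_principal_iff.2 hb)
    exact ⟨z, hz⟩
  refine ⟨z, hcl z hz, Metric.tendsto_nhds.2 fun ε hε => ?_⟩
  -- Near `z` infinitely often, the weighted distance to `P n` has limit `l ≤ 4Cδ²`; eventually it
  -- is below `l + δ²`, so the squared distance is at most `κδ²`.
  set κ := (4 * C + 1) / c with hκ
  have hκ0 : 0 < κ := by positivity
  set δ := ε / (2 * (1 + κ)) with hδdef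
  have hδ : 0 < δ := by positivity
  have hδε : δ * (1 + κ) = ε / 2 := by rw [hδdef]; field_simp
  obtain ⟨n, hn⟩ := hP z (hcl z hz) δ hδ
  obtain ⟨l, hl⟩ := hconv n
  have hl' : l ≤ 4 * C * δ ^ 2 := by
    have hfreq : ∃ᶠ t in atTop, dist (Z t) z < δ := hz.frequently (Metric.ball_mem_nhds z hδ)
    refine le_of_tendsto_of_frequently hl ((hfreq.and_eventually (hupp' n)).mono ?_)
    rintro t ⟨h1, h2⟩
    refine h2.trans ?_
    have h3 : ‖Z t - P n‖ ≤ 2 * δ := by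
      rw [← dist_eq_norm]
      linarith [dist_triangle (Z t) z (P n)]
    nlinarith [pow_le_pow_left₀ (norm_nonneg _) h3 2]
  have hδ2 : 0 < δ ^ 2 := by positivity
  filter_upwards [hlow' n, hl.eventually (gt_mem_nhds (lt_add_of_pos_right l hδ2))] with t h1 h2
  have h3 : ‖Z t - P n‖ ^ 2 ≤ κ * δ ^ 2 := by
    rw [hκ, div_mul_eq_mul_div, le_div_iff₀ hc]
    linarith
  have h4 : ‖Z t - P n‖ ≤ ε / 2 := by
    refine le_of_sq_le_sq ?_ (by positivity)
    rw [← hδε]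
    nlinarith [mul_pos hκ0 hδ2]
  have h5 : δ < ε / 2 := by nlinarith
  calc dist (Z t) z ≤ dist (Z t) (P n) + dist (P n) z := dist_triangle _ _ _
    _ < ε := by
      rw [dist_eq_norm, dist_comm (P n)]
      linarith

end Opial

theorem isNash_of_indivGrad_eq_zero {N : ℕ} {d : Fin N → ℕ} {ℓ : Fin N → JointAction d → ℝ}
    {L : ℝ≥0} (hsm : ConvexSmooth ℓ L) {z : JointAction d} (hz : ∀ i, indivGrad ℓ i z = 0) :
    IsNash ℓ z := by
  intro i y
  have h := ConvexOn.le_of_gradient_eq_zero (hsm.convex i z) (hsm.differentiable i z (z i))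
    (hz i) y
  have e : deviate z i (z i) = z := by
    rw [deviate, Function.update_eq_self]
  rwa [e] at h

theorem sum_range_succ_eq_sum_Icc (f : ℕ → ℝ) (n : ℕ) :
    ∑ k ∈ Finset.range n, f (k + 1) = ∑ t ∈ Finset.Icc 1 n, f t := by
  induction n with
  | zero => simp
  | succ n ih => rw [Finset.sum_range_succ, ih, Finset.sum_Icc_succ_top (by omega)]

/-! ### Limits of the step sizes, summable gradients and convergence of the iterates -/

section Convergence

variable {N : ℕ} {d : Fin N → ℕ} {Ω : Type*} {m0 : MeasurableSpace Ω} {μ : Measure Ω}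
  {ℓ : Fin N → JointAction d → ℝ} {L : ℝ≥0} {σM G B q R : ℝ}
  {ξ : ℕ → (i : Fin N) → Ω → Action d i} {X x : ℕ → Ω → JointAction d}

local notation "fb" => feedback ℓ x ξ
local notation "stepγ" => extrapStep q (feedback ℓ x ξ)
local notation "stepρ" => invStep (feedback ℓ x ξ) X
local notation "nsq" => normalizedSq (feedback ℓ x ξ)
local notation "wt" => stepWeight (feedback ℓ x ξ) X

theorem stepWeight_mono {i : Fin N} {ω : Ω} : Monotone fun t => wt t i ω := fun s t hst => by
  have h1 := cumSq_mono (g := fb) (i := i) (ω := ω) hst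
  have h2 := pathSq_mono (X := X) (i := i) (ω := ω) hst
  exact Real.sqrt_le_sqrt (by simp only at h1 h2; linarith)

theorem tendsto_extrapStep {i : Fin N} {ω : Ω} {l : ℝ}
    (hl : Tendsto (fun t => cumSq fb t i ω) atTop (𝓝 l)) :
    ∃ γ' : ℝ, 0 < γ' ∧ Tendsto (fun t => stepγ t i ω) atTop (𝓝 γ') := by
  have hl0 : 0 ≤ l := ge_of_tendsto' hl fun t => cumSq_nonneg
  have hpos : 0 < (1 + l) ^ (1 / 2 - q) := Real.rpow_pos_of_pos (by linarith) _
  refine ⟨1 / (1 + l) ^ (1 / 2 - q), one_div_pos.2 hpos, ?_⟩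
  have h1 := (hl.comp (tendsto_sub_atTop_nat 2)).const_add 1
  exact tendsto_const_nhds.div (h1.rpow_const (Or.inl (by linarith))) hpos.ne'

theorem tendsto_invStep {i : Fin N} {ω : Ω} {l m : ℝ}
    (hl : Tendsto (fun t => cumSq fb t i ω) atTop (𝓝 l))
    (hm : Tendsto (fun t => pathSq X t i ω) atTop (𝓝 m)) :
    ∃ ρ' : ℝ, 0 < ρ' ∧ Tendsto (fun t => stepρ t i ω) atTop (𝓝 ρ') := by
  have hl0 : 0 ≤ l := ge_of_tendsto' hl fun t => cumSq_nonneg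
  have hm0 : 0 ≤ m := ge_of_tendsto' hm fun t => pathSq_nonneg
  refine ⟨√(1 + l + m), Real.sqrt_pos.2 (by linarith), ?_⟩
  exact (((hl.comp (tendsto_sub_atTop_nat 2)).const_add 1).add
    (hm.comp (tendsto_sub_atTop_nat 2))).sqrt

theorem tendsto_updateStep {i : Fin N} {ω : Ω} {ρ' : ℝ} (hρ : 0 < ρ')
    (h : Tendsto (fun t => stepρ t i ω) atTop (𝓝 ρ')) :
    Tendsto (fun t => updateStep fb X t i ω) atTop (𝓝 (1 / ρ')) :=
  tendsto_const_nhds.div h hρ.ne'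

theorem summable_feedback {i : Fin N} {ω : Ω} {l : ℝ}
    (hl : Tendsto (fun t => cumSq fb t i ω) atTop (𝓝 l)) :
    Summable fun t => ‖fb (t + 1) i ω‖ ^ 2 := by
  refine summable_of_sum_range_le (c := l) (fun t => by positivity) fun n => ?_
  rw [sum_range_succ_eq_sum_Icc (fun t => ‖fb t i ω‖ ^ 2)]
  exact cumSq_mono.ge_of_tendsto hl n

theorem tendsto_feedback {i : Fin N} {ω : Ω} {l : ℝ}
    (hl : Tendsto (fun t => cumSq fb t i ω) atTop (𝓝 l)) :
    Tendsto (fun t => ‖fb t i ω‖) atTop (𝓝 0) := by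
  have h := (summable_feedback hl).tendsto_atTop_zero.sqrt
  simp only [Real.sqrt_sq (norm_nonneg _), Real.sqrt_zero] at h
  exact (tendsto_add_atTop_iff_nat 1).1 h

namespace NoisyRun

variable [IsProbabilityMeasure μ]

/-- The expectations of the increasing sequence `wt` are bounded, so `wt` is almost surely bounded,
and it dominates both monotone sums. -/
theorem ae_tendsto_cumSq_pathSq (h : NoisyRun μ ℓ L σM G B q R ξ X x) :
    ∀ᵐ ω ∂μ, ∀ i, (∃ l, Tendsto (fun t => cumSq fb t i ω) atTop (𝓝 l)) ∧
      ∃ m, Tendsto (fun t => pathSq X t i ω) atTop (𝓝 m) := by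
  obtain ⟨C, hC⟩ := h.exists_uniform_bound
  refine ae_all_iff.2 fun i => ?_
  have hb := ae_bddAbove_of_integral_le (C := C) (f := fun T => wt T i)
    (h.integrable_weight i) (fun T ω => Real.sqrt_nonneg _) (fun ω => stepWeight_mono)
    fun T => (Finset.single_le_sum (f := fun i => ∫ ω, wt T i ω ∂μ)
      (fun j _ => integral_nonneg fun ω => Real.sqrt_nonneg _) (Finset.mem_univ i)).trans
        (hC T).2.2
  filter_upwards [hb] with ω ⟨K, hK⟩
  have hsq : ∀ t, 1 + cumSq fb t i ω + pathSq X t i ω ≤ K ^ 2 := by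
    intro t
    have h1 : wt t i ω ≤ K := hK ⟨t, rfl⟩
    have h2 := pow_le_pow_left₀ (Real.sqrt_nonneg _) h1 2
    rwa [Real.sq_sqrt] at h2
    linarith [cumSq_nonneg (g := fb) (t := t) (i := i) (ω := ω),
      pathSq_nonneg (X := X) (t := t) (i := i) (ω := ω)]
  refine ⟨⟨_, tendsto_atTop_ciSup cumSq_mono ⟨K ^ 2, ?_⟩⟩,
    ⟨_, tendsto_atTop_ciSup pathSq_mono ⟨K ^ 2, ?_⟩⟩⟩
  · rintro _ ⟨t, rfl⟩
    linarith [hsq t, pathSq_nonneg (X := X) (t := t) (i := i) (ω := ω)]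
  · rintro _ ⟨t, rfl⟩
    linarith [hsq t, cumSq_nonneg (g := fb) (t := t) (i := i) (ω := ω)]

/-- `∑ γ_t‖V‖²` is almost surely finite, and `γ` decreases to a positive limit, so the weights can
be divided out. -/
theorem ae_summable_grad (h : NoisyRun μ ℓ L σM G B q R ξ X x) :
    ∀ᵐ ω ∂μ, ∀ i, Summable fun t => ‖indivGrad ℓ i (x t ω)‖ ^ 2 := by
  obtain ⟨C, hC⟩ := h.exists_uniform_bound
  have hnn : ∀ i T (ω : Ω), 0 ≤ ∑ t ∈ Finset.Icc 1 T,
      stepγ t i ω * ‖indivGrad ℓ i (x t ω)‖ ^ 2 := fun i T ω =>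
    Finset.sum_nonneg fun t _ => mul_nonneg extrapStep_pos.le (by positivity)
  have hb : ∀ᵐ ω ∂μ, ∀ i, BddAbove (Set.range fun T => ∑ t ∈ Finset.Icc 1 T,
      stepγ t i ω * ‖indivGrad ℓ i (x t ω)‖ ^ 2) := by
    refine ae_all_iff.2 fun i => ae_bddAbove_of_integral_le (C := C)
      (h.integrable_gradEnergy i) (hnn i) (fun ω s t hst => ?_) fun T => ?_
    · exact sum_Icc_mono (a := fun t => stepγ t i ω * ‖indivGrad ℓ i (x t ω)‖ ^ 2)
        (fun t => mul_nonneg extrapStep_pos.le (by positivity)) hst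
    · exact (Finset.single_le_sum (f := fun i => ∫ ω, ∑ t ∈ Finset.Icc 1 T,
        stepγ t i ω * ‖indivGrad ℓ i (x t ω)‖ ^ 2 ∂μ)
        (fun j _ => integral_nonneg fun ω => hnn j T ω) (Finset.mem_univ i)).trans (hC T).1
  filter_upwards [hb, h.ae_tendsto_cumSq_pathSq] with ω h1 h2 i
  obtain ⟨K, hK⟩ := h1 i
  obtain ⟨l, hl⟩ := (h2 i).1
  obtain ⟨γ', hγ', hlim⟩ := tendsto_extrapStep (q := q) hl
  refine (summable_nat_add_iff 1).1 (summable_of_sum_range_le (c := K / γ')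
    (fun t => by positivity) fun n => ?_)
  rw [sum_range_succ_eq_sum_Icc (fun t => ‖indivGrad ℓ i (x t ω)‖ ^ 2), le_div_iff₀ hγ',
    mul_comm, Finset.mul_sum]
  refine le_trans (Finset.sum_le_sum fun t _ => mul_le_mul_of_nonneg_right ?_ (by positivity))
    (hK ⟨n, rfl⟩)
  exact (extrapStep_antitone h.q_le).le_of_tendsto hlim t

end NoisyRun

/-- The error of the energy inequality in round `t`, without exploiting the negative drift. -/
noncomputable def coarseError (g : ℕ → (i : Fin N) → Ω → Action d i)
    (q : ℝ) (X : ℕ → Ω → JointAction d) (p : JointAction d) (t : ℕ) (ω : Ω) : ℝ :=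
  ∑ i, ((invStep g X (t + 1) i ω - invStep g X t i ω) * ‖X 1 ω i - p i‖ ^ 2 +
    normalizedSq g t i ω + extrapStep q g t i ω * (‖g t i ω‖ ^ 2 + ‖g (t - 1) i ω‖ ^ 2))

theorem coarseError_nonneg {g : ℕ → (i : Fin N) → Ω → Action d i} {p : JointAction d} {t : ℕ}
    {ω : Ω} : 0 ≤ coarseError g q X p t ω := by
  refine Finset.sum_nonneg fun i _ => add_nonneg (add_nonneg (mul_nonneg ?_ (by positivity))
    normalizedSq_nonneg) (mul_nonneg extrapStep_pos.le (by positivity))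
  exact sub_nonneg.2 (invStep_mono (Nat.le_succ t))

theorem sum_coarseError_le {ω : Ω} {M : ℝ} (hq1 : q ≤ 1 / 4) (hfb : ∀ t i, ‖fb t i ω‖ ≤ M)
    (hR : ‖X 1 ω‖ ≤ R) (p : JointAction d) (T : ℕ) :
    ∑ t ∈ Finset.Icc 1 T, coarseError fb q X p t ω ≤
      ((R + ‖p‖) ^ 2 + 2 * √(1 + 2 * M ^ 2)) * ∑ i, wt T i ω +
        2 * ∑ i, ∑ t ∈ Finset.Icc 1 T, stepγ t i ω * ‖fb t i ω‖ ^ 2 := by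
  simp only [coarseError]
  rw [Finset.sum_comm, Finset.mul_sum, Finset.mul_sum, ← Finset.sum_add_distrib]
  refine Finset.sum_le_sum fun i _ => ?_
  have h1 := sum_step_init_le (ℓ := ℓ) (x := x) (ξ := ξ) hR p i T
  have h2 := sum_normalizedSq_le (ℓ := ℓ) (x := x) (ξ := ξ) (X := X) hfb i T
  have h3 := sum_Icc_pred_le (f := fun t => stepγ t i ω * ‖fb t i ω‖ ^ 2)
    (fun t => mul_nonneg extrapStep_pos.le (by positivity)) (by simp [feedback_zero]) T
  have h4 : ∑ t ∈ Finset.Icc 1 T, stepγ t i ω * (‖fb t i ω‖ ^ 2 + ‖fb (t - 1) i ω‖ ^ 2) ≤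
      ∑ t ∈ Finset.Icc 1 T, (stepγ t i ω * ‖fb t i ω‖ ^ 2 +
        stepγ (t - 1) i ω * ‖fb (t - 1) i ω‖ ^ 2) := by
    refine Finset.sum_le_sum fun t _ => ?_
    have h5 : stepγ t i ω ≤ stepγ (t - 1) i ω := extrapStep_antitone hq1 (Nat.sub_le t 1)
    have h6 := mul_le_mul_of_nonneg_right h5 (sq_nonneg ‖fb (t - 1) i ω‖)
    linarith
  rw [Finset.sum_add_distrib] at h4
  rw [Finset.sum_add_distrib, Finset.sum_add_distrib]
  linarith

namespace NoisyRun

/-- Young's inequality now spends the entire path drift, and the correlation is bounded crudely: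
once `E ∑ γ‖g‖²` is known to be bounded, no cancellation is needed. -/
theorem weightedDist_step (h : NoisyRun μ ℓ L σM G B q R ξ X x) (p : JointAction d) {t : ℕ}
    (ht : 1 ≤ t) (ω : Ω) :
    ∑ i, weightedDist fb X p (t + 1) i ω ≤ ∑ i, weightedDist fb X p t i ω +
      coarseError fb q X p t ω - ∑ i, 2 * inner ℝ (fb t i ω) (x t ω i - p i) := by
  rw [coarseError, ← Finset.sum_add_distrib, ← Finset.sum_sub_distrib]
  refine Finset.sum_le_sum fun i _ => ?_
  have h1 := h.run.descent ht p i ω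
  have hρ := invStep_pos (g := fb) (X := X) (t := t) (i := i) (ω := ω)
  have h2 := inner_young (a := fb t i ω) (b := X t ω i - X (t + 1) ω i)
    (c := 1 / stepρ t i ω) (by positivity)
  have h3 := sq_div_invStep_le (g := fb) (X := X) (t := t) (i := i) (ω := ω)
  have e1 : 1 / stepρ t i ω * ‖fb t i ω‖ ^ 2 = ‖fb t i ω‖ ^ 2 / stepρ t i ω := by ring
  have e2 : ‖X t ω i - X (t + 1) ω i‖ ^ 2 / (1 / stepρ t i ω) =
      stepρ t i ω * ‖X t ω i - X (t + 1) ω i‖ ^ 2 := by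
    rw [div_div_eq_mul_div]; ring
  rw [e1, e2] at h2
  have h4 : -2 * inner ℝ (fb t i ω) (fb (t - 1) i ω) ≤ ‖fb t i ω‖ ^ 2 + ‖fb (t - 1) i ω‖ ^ 2 := by
    have := norm_add_sq_real (fb t i ω) (fb (t - 1) i ω)
    nlinarith [sq_nonneg ‖fb t i ω + fb (t - 1) i ω‖]
  have h5 := mul_le_mul_of_nonneg_left h4
    (extrapStep_pos (q := q) (g := fb) (t := t) (i := i) (ω := ω)).le
  linarith

theorem coarseError_bddMeas (h : NoisyRun μ ℓ L σM G B q R ξ X x) (p : JointAction d) {t : ℕ}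
    (ht : 1 ≤ t) : BddMeas (playHistory x (t + 1)) μ (coarseError fb q X p t) := by
  have hk := h.knowsUntil (Nat.le_add_left 1 t)
  refine BddMeas.sum _ fun i _ => BddMeas.add (BddMeas.add ?_ ?_) ?_
  · exact ((hk.invStep h.run (by omega) (by omega) i).sub
      (hk.invStep h.run (by omega) (by omega) i)).mul
        ((hk.start i).sub (BddMeas.const _)).norm_sq
  · exact hk.normalizedSq (Nat.lt_succ_self t) i
  · exact (hk.extrapStep h.q_le (by omega) (by omega) i).mul
      ((hk.feedback t (by omega) i).norm_sq.add (hk.feedback (t - 1) (by omega) i).norm_sq)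

variable [IsProbabilityMeasure μ]

theorem condExp_regret_nonneg (h : NoisyRun μ ℓ L σM G B q R ξ X x) {p : JointAction d}
    (hp : IsNash ℓ p) {t : ℕ} (ht : 1 ≤ t) :
    0 ≤ᵐ[μ] μ[fun ω => ∑ i, 2 * inner ℝ (fb t i ω) (x t ω i - p i) | playHistory x t] := by
  have hk := h.knowsUntil ht
  have hm := h.playHistory_le t
  have hxp : ∀ i, BddMeas (playHistory x t) μ (fun ω => (2 : ℝ) • (x t ω i - p i)) := fun i =>
    (BddMeas.const _).smul (((hk.play h.run h.q_le ht le_rfl).apply i).sub (BddMeas.const _))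
  set a : Ω → ℝ := fun ω => ∑ i, inner ℝ (indivGrad ℓ i (x t ω)) ((2 : ℝ) • (x t ω i - p i))
    with ha
  set c : Fin N → Ω → ℝ := fun i ω => inner ℝ (ξ t i ω) ((2 : ℝ) • (x t ω i - p i)) with hc
  have haM : BddMeas (playHistory x t) μ a := BddMeas.sum _ fun i _ =>
    (hk.grad h.run h.q_le h.smooth ht le_rfl i).inner (hxp i)
  have hcint : ∀ i, Integrable (c i) μ := fun i =>
    ((h.noise_bddMeas ht i).inner ((hxp i).mono hm)).integrable le_rfl
  have e : (fun ω => ∑ i, 2 * inner ℝ (fb t i ω) (x t ω i - p i)) = a + ∑ i, c i := by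
    funext ω
    rw [Pi.add_apply, Finset.sum_apply, ← Finset.sum_add_distrib]
    refine Finset.sum_congr rfl fun i _ => ?_
    rw [hc, ← inner_add_left, ← feedback_of_pos ht, inner_smul_right]
  rw [e]
  have h1 := condExp_add (haM.integrable hm) (integrable_finsetSum' Finset.univ fun i _ => hcint i)
    (playHistory x t)
  have h2 := condExp_finsetSum (s := Finset.univ) (fun i _ => hcint i) (playHistory x t)
  have h3 := condExp_of_stronglyMeasurable hm haM.meas (haM.integrable hm)
  have h4 : ∀ᵐ ω ∂μ, ∀ i, μ[c i | playHistory x t] ω = 0 := ae_all_iff.2 fun i =>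
    condExp_inner_eq_zero hm (h.noise_bddMeas ht i) (h.noise.unbiased t ht i) (hxp i)
  filter_upwards [h1, h2, h4] with ω h1 h2 h4
  rw [h1, Pi.add_apply, h2, h3, Finset.sum_apply, Finset.sum_eq_zero fun i _ => h4 i, add_zero]
  have h5 := h.stable.sum_inner_nonneg hp (x t ω)
  simp only [ha, inner_smul_right, ← Finset.mul_sum, Pi.zero_apply]
  linarith

/-- The uniform bounds make the total coarse error integrable, and the regret is conditionally
nonnegative, so Robbins–Siegmund applies. -/
theorem ae_tendsto_weightedDist (h : NoisyRun μ ℓ L σM G B q R ξ X x) {p : JointAction d}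
    (hp : IsNash ℓ p) :
    ∀ᵐ ω ∂μ, ∃ l, Tendsto (fun t => ∑ i, weightedDist fb X p t i ω) atTop (𝓝 l) := by
  obtain ⟨C, hC⟩ := h.exists_uniform_bound
  -- Rounds start at `1`, hence the shift of the index by one.
  let ℱ : Filtration ℕ m0 := ⟨fun n => playHistory x (n + 1),
    fun _ _ hab => playHistory_mono x (Nat.add_le_add_right hab 1), fun n => h.playHistory_le _⟩
  have hmain := ae_tendsto_of_almost_supermartingale ℱ (μ := μ)
    (u := fun n ω => ∑ i, weightedDist fb X p (n + 1) i ω)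
    (b := fun n => coarseError fb q X p (n + 1))
    (v := fun n ω => ∑ i, 2 * inner ℝ (fb (n + 1) i ω) (x (n + 1) ω i - p i))
    (C := ((R + ‖p‖) ^ 2 + 2 * √(1 + 2 * (|G| + |B|) ^ 2)) * C + 2 * C)
    (fun n => BddMeas.sum _ fun i _ => (h.knowsUntil (Nat.le_add_left 1 n)).weightedDist h.run p
      (Nat.le_add_left 1 n) le_rfl i)
    (fun n => h.coarseError_bddMeas p (Nat.le_add_left 1 n))
    (fun n => BddMeas.sum _ fun i _ => by
      have hk := h.knowsUntil_ambient (n + 2)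
      exact (BddMeas.const _).mul ((hk.feedback _ (by omega) i).inner
        (((hk.play h.run h.q_le (Nat.le_add_left 1 n) (by omega)).apply i).sub
          (BddMeas.const _))))
    (fun n ω => Finset.sum_nonneg fun i _ => weightedDist_nonneg)
    (fun n ω => coarseError_nonneg)
    (fun n => ae_of_all _ fun ω => h.weightedDist_step p (Nat.le_add_left 1 n) ω)
    (fun n => h.condExp_regret_nonneg hp (Nat.le_add_left 1 n))
    (fun n => ?_)
  · filter_upwards [hmain] with ω ⟨l, hl⟩
    exact ⟨l, (tendsto_add_atTop_iff_nat 1).1 hl⟩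
  · have i1 := (integrable_finsetSum Finset.univ fun i _ => h.integrable_weight i n).const_mul
      ((R + ‖p‖) ^ 2 + 2 * √(1 + 2 * (|G| + |B|) ^ 2))
    have i2 := (integrable_finsetSum Finset.univ
      fun i _ => h.integrable_feedbackEnergy i n).const_mul 2
    have hle := integral_mono_ae (μ := μ) (integrable_finsetSum (Finset.range n) fun k _ =>
      (h.coarseError_bddMeas p (Nat.le_add_left 1 k)).integrable (h.playHistory_le _))
      (i1.add i2) (by
        filter_upwards [h.ae_feedback_le, h.init_le] with ω h1 h2
        rw [sum_range_succ_eq_sum_Icc (fun t => coarseError fb q X p t ω)]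
        exact sum_coarseError_le h.q_le h1 h2 p n)
    rw [integral_add' i1 i2, integral_const_mul, integral_const_mul,
      integral_finsetSum _ fun i _ => h.integrable_weight i n,
      integral_finsetSum _ fun i _ => h.integrable_feedbackEnergy i n] at hle
    refine hle.trans (add_le_add ?_ ?_)
    · exact mul_le_mul_of_nonneg_left (hC n).2.2 (by positivity)
    · exact mul_le_mul_of_nonneg_left (hC n).2.1 (by norm_num)

/-- The exceptional null set in `ae_tendsto_weightedDist` depends on the equilibrium, so only a
countable dense family can be treated simultaneously. -/
theorem ae_tendsto_nash (h : NoisyRun μ ℓ L σM G B q R ξ X x) :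
    ∀ᵐ ω ∂μ, ∃ z, IsNash ℓ z ∧ Tendsto (fun t => X t ω) atTop (𝓝 z) ∧
      Tendsto (fun t => x t ω) atTop (𝓝 z) := by
  obtain ⟨p₀, hp₀⟩ := h.stable.exists_nash
  have : Nonempty {p // IsNash ℓ p} := ⟨⟨p₀, hp₀⟩⟩
  have hdist : ∀ᵐ ω ∂μ, ∀ n, ∃ l, Tendsto (fun t => ∑ i, weightedDist fb X
      (TopologicalSpace.denseSeq {p // IsNash ℓ p} n) t i ω) atTop (𝓝 l) :=
    ae_all_iff.2 fun n =>
      h.ae_tendsto_weightedDist (TopologicalSpace.denseSeq {p // IsNash ℓ p} n).2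
  filter_upwards [hdist, h.ae_tendsto_cumSq_pathSq, h.ae_summable_grad] with ω h1 h2 h3
  choose hcum hpath using h2
  choose l hl using hcum
  choose m hm using hpath
  choose ρ' hρ' hρlim using fun i => tendsto_invStep (hl i) (hm i)
  have hdiff : Tendsto (fun t => x t ω - X t ω) atTop (𝓝 0) := by
    have hcoord : ∀ i, Tendsto (fun t => ‖x t ω i - X t ω i‖) atTop (𝓝 0) := by
      intro i
      have hg := (tendsto_feedback (hl i)).comp (tendsto_sub_atTop_nat 1)
      refine squeeze_zero' (Eventually.of_forall fun t => norm_nonneg _) ?_ hg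
      filter_upwards [eventually_ge_atTop 1] with t ht
      rw [h.run.extrapolate t ht, sub_sub_cancel_left, norm_neg, norm_smul,
        Real.norm_of_nonneg extrapStep_pos.le]
      exact mul_le_of_le_one_left (norm_nonneg _) (extrapStep_le_one h.q_le)
    have hsq : Tendsto (fun t => ‖x t ω - X t ω‖ ^ 2) atTop (𝓝 0) := by
      have e : ∀ t, ‖x t ω - X t ω‖ ^ 2 = ∑ i, ‖x t ω i - X t ω i‖ ^ 2 := fun t =>
        PiLp.norm_sq_eq_of_L2 _ _
      rw [funext e]
      simpa only [ne_eq, OfNat.ofNat_ne_zero, not_false_eq_true, zero_pow, Finset.sum_const_zero]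
        using tendsto_finsetSum Finset.univ fun i _ => (hcoord i).pow 2
    rw [tendsto_zero_iff_norm_tendsto_zero]
    simpa [Real.sqrt_sq (norm_nonneg _)] using hsq.sqrt
  -- Gradients vanish along the played actions by summability, and along `X` because `x - X = -γ g`
  -- tends to zero.
  have hgrad : ∀ i, Tendsto (fun t => indivGrad ℓ i (X t ω)) atTop (𝓝 0) := by
    intro i
    have hx : Tendsto (fun t => indivGrad ℓ i (x t ω)) atTop (𝓝 0) := by
      rw [tendsto_zero_iff_norm_tendsto_zero]
      simpa [Real.sqrt_sq (norm_nonneg _)] using (h3 i).tendsto_atTop_zero.sqrt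
    have hsub : Tendsto (fun t => indivGrad ℓ i (x t ω) - indivGrad ℓ i (X t ω)) atTop (𝓝 0) := by
      have hL : Tendsto (fun t => (L : ℝ) * ‖x t ω - X t ω‖) atTop (𝓝 0) := by
        simpa using (tendsto_zero_iff_norm_tendsto_zero.1 hdiff).const_mul (L : ℝ)
      exact squeeze_zero_norm (fun t => (h.smooth.lipschitz i).norm_sub_le _ _) hL
    simpa using hx.sub hsub
  obtain ⟨z, hz, hlim⟩ := exists_tendsto_of_weighted_dist
    (Z := fun t => X t ω) (S := {p | IsNash ℓ p}) hρlim hρ'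
    (P := fun n => (TopologicalSpace.denseSeq {p // IsNash ℓ p} n : JointAction d))
    (fun z hz δ hδ => (TopologicalSpace.denseRange_denseSeq {p // IsNash ℓ p}).exists_dist_lt
      ⟨z, hz⟩ hδ) h1 (fun z hz => isNash_of_indivGrad_eq_zero h.smooth fun i => by
        have hcl : MapClusterPt (indivGrad ℓ i z) atTop (fun t => indivGrad ℓ i (X t ω)) :=
          hz.continuousAt_comp (h.smooth.lipschitz i).continuous.continuousAt
        have hne : (𝓝 (indivGrad ℓ i z) ⊓ 𝓝 0).NeBot :=
          NeBot.mono hcl (inf_le_inf_left _ (hgrad i))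
        exact eq_of_nhds_neBot hne)
  exact ⟨z, hz, hlim, by simpa using hdiff.add hlim⟩

end NoisyRun

end Convergence

end NoisyGame

theorem mainTheorem5 {N : ℕ} {d : Fin N → ℕ}
    {Ω : Type*} [MeasurableSpace Ω] (μ : Measure Ω) [IsProbabilityMeasure μ]
    (ℓ : Fin N → NoisyGame.JointAction d → ℝ) (L : ℝ≥0) (σM G B q R : ℝ)
    (ξ : ℕ → (i : Fin N) → Ω → NoisyGame.Action d i)
    (X x : ℕ → Ω → NoisyGame.JointAction d)
    (hq0 : 0 < q) (hq1 : q ≤ 1 / 4)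
    (hsmooth : NoisyGame.ConvexSmooth ℓ L)
    (hstable : NoisyGame.VariationallyStable ℓ)
    (hnoise : NoisyGame.NoiseModel μ ℓ x ξ 0 σM)
    (hbdd : NoisyGame.BoundedFeedback μ ℓ ξ G B)
    (hX1 : Measurable (X 1)) (hX1_bdd : ∀ᵐ ω ∂μ, ‖X 1 ω‖ ≤ R)
    (hrun : NoisyGame.RunsAdaptiveOptDAPlus ℓ q ξ X x) :
    (∀ᵐ ω ∂μ, ∀ i : Fin N,
      (∃ l : ℝ, Tendsto (fun t => NoisyGame.cumSq (NoisyGame.feedback ℓ x ξ) t i ω)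
        atTop (𝓝 l)) ∧
      (∃ m : ℝ, Tendsto (fun t => NoisyGame.pathSq X t i ω) atTop (𝓝 m))) ∧
    (∀ᵐ ω ∂μ, ∀ i : Fin N,
      (∃ γ : ℝ, 0 < γ ∧
        Tendsto (fun t => NoisyGame.extrapStep q (NoisyGame.feedback ℓ x ξ) t i ω)
          atTop (𝓝 γ)) ∧
      (∃ η : ℝ, 0 < η ∧
        Tendsto (fun t => NoisyGame.updateStep (NoisyGame.feedback ℓ x ξ) X t i ω)
          atTop (𝓝 η))) ∧
    (∀ᵐ ω ∂μ, Summable (fun t => ‖NoisyGame.jointGrad ℓ (x t ω)‖ ^ 2)) ∧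
    (∀ᵐ ω ∂μ, ∃ xs : NoisyGame.JointAction d, NoisyGame.IsNash ℓ xs ∧
      Tendsto (fun t => X t ω) atTop (𝓝 xs) ∧ Tendsto (fun t => x t ω) atTop (𝓝 xs)) := by
  have h : NoisyGame.NoisyRun μ ℓ L σM G B q R ξ X x :=
    ⟨hq0, hq1, hsmooth, hstable, hnoise, hbdd, hX1, hX1_bdd, hrun⟩
  refine ⟨h.ae_tendsto_cumSq_pathSq, ?_, ?_, h.ae_tendsto_nash⟩
  · filter_upwards [h.ae_tendsto_cumSq_pathSq] with ω hω i
    obtain ⟨⟨l, hl⟩, m, hm⟩ := hω i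
    obtain ⟨ρ, hρ, hlim⟩ := NoisyGame.tendsto_invStep hl hm
    exact ⟨NoisyGame.tendsto_extrapStep hl, 1 / ρ, one_div_pos.2 hρ,
      NoisyGame.tendsto_updateStep hρ hlim⟩
  · filter_upwards [h.ae_summable_grad] with ω hω
    have e : ∀ t, ‖NoisyGame.jointGrad ℓ (x t ω)‖ ^ 2 =
        ∑ i, ‖NoisyGame.indivGrad ℓ i (x t ω)‖ ^ 2 := fun t => PiLp.norm_sq_eq_of_L2 _ _
    rw [funext e]
    exact summable_sum fun i _ => hω i
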